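/- For integers $\alpha,\beta\neq 1$ let $G(\alpha,\beta)=\langle A,B \mid A^{[A,B]}=A^{\alpha},\ B^{[B,A]}=B^{\beta}\rangle$, where $[x,y]=x^{-1}y^{-1}xy$ and $y^x=x^{-1}yx$; put $C=[A,B]$. These groups are finite and nilpotent. For a prime $p$ let $G(\alpha,\beta)_p$ be the Sylow $p$-subgroup, and let $a,b,c$ be the images of $A,B,C$ under the canonical projection $G(\alpha,\beta)\to G(\alpha,\beta)_p$ (the homomorphism that is the identity on $G(\alpha,\beta)_p$). Put $m=v_p(\alpha-1)$, $n=v_p(\beta-1)$, $\ell=v_p(\alpha-\beta)\in\mathbb N\cup\{\infty\}$, and write $\alpha=1+p^mu$ and, if $\alpha\ne\beta$, $\alpha-\beta=p^{\ell}k$, with $p\nmid u,k$. Let $e=v_p(|G(\alpha,\beta)|)$, let $f$ be the nilpotency class of $G(\alpha,\beta)_p$, and let $o(x)$ be the order of $x$. **Theorem.** Let $\alpha,\beta\neq 1$ be integers and let $p$ be a prime. There are integers $\alpha_0,\beta_0>1$ such that the following hold, where the index $0$ marks the objects attached to $(\alpha_0,\beta_0)$. 1. There is an isomorphism $G(\alpha,\beta)_p\cong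 G(\alpha_0,\beta_0)_p$ that maps $a\mapsto a_0$ and $b\mapsto b_0$ (hence $c\mapsto c_0$). 2. The $p$-adic parameters are preserved: $m_0=m$, $n_0=n$, $\ell_0=\ell$. If $p=3$, then $\alpha_0\equiv\alpha$ and $\beta_0\equiv\beta \pmod{27}$. If $p\neq2$, $m=n>0$ and $2\ell=3m$, then with $s=v_p(2k^2-u^3)$ we have $s_0=s$ whenever $s<m/2$ or $s_0<m/2$. If $p=2$, $m=n\geq5$ and $2\ell+2=3m+1$, then with $s=v_2(k^2-u^3)$ we have $s_0=s$ whenever $s<(m-3)/2$ or $s_0<(m-3)/2$. 3. Every structure theorem extends from $(\alpha_0,\beta_0)$ to $(\alpha,\beta)$: for each $i=1,\dots,19$, assertion $(i)$ below holds for $(\alpha,\beta)$ and $p$ if and only if it holds for $(\alpha_0,\beta_0)$ and $p$. *Assertions (1)–(5)*, under the assumption that $m,n>0$ and that either $p>3$, or $p=3$ and $\alpha,\beta\not\equiv7\pmod 9$: (1) if $m\ge n=\ell$, then $e=4n+m$, $f=3$, $o(a)=p^{m+n}$, $o(b)=p^{2n}$, $o(c)=p^n$; (2) if $m=n$ and $\ell\ge2m$,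 then $e=7m$, $f=5$, $o(a)=o(b)=p^{3m}$, $o(c)=p^{2m}$; (3) if $m=n<\ell<2m$ and $2\ell<3m$, then $e=2m+3\ell$, $f=5$, $o(a)=o(b)=p^{m+\ell}$, $o(c)=p^{2\ell-m}$; (4) if $m=n<\ell<2m$ and $2\ell>3m$, then $e=5m+\ell$, $f=5$, $o(a)=o(b)=p^{m+\ell}$, $o(c)=p^{2m}$; (5) if $m=n$, $2\ell=3m$ and $s=v_p(2k^2-u^3)$, then $f=5$ if $s=0$ and $f=6$ if $s>0$; if $s\le m/2$, then $e=s+13m/2$, $o(a)=o(b)=p^{s+5m/2}$, $o(c)=p^{2m+s}$; if $s\ge m/2$, then $e=7m$, $o(a)=o(b)=p^{3m}$, $o(c)=p^{5m/2}$. *Assertions (6)–(9)*, for $p=3$ and $\alpha\equiv7\pmod9$: (6) if $\beta\equiv7\pmod 9$ and $\alpha\equiv\beta\pmod{27}$, then $e=10$, $f=7$, $o(a)=o(b)=81$, $o(c)=27$; (7) if $\beta\equiv7\pmod 9$ and $\ell=2$, then $e=8$, $f=5$, $o(a)=o(b)=27$, $o(c)=9$; (8) if $\beta\equiv4\pmod9$,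 then $e=5$, $f=3$, $o(a)=o(b)=9$, $o(c)=3$; (9) if $\beta\equiv1\pmod9$, then $e=n+4$, $f=3$, $o(a)=9$, $o(b)=3^{n+1}$, $o(c)=3$. *Assertions (10)–(19)*, for $p=2$: (10) if $m=n=1$, then $e=4$, $f=3$, $o(a)=o(b)=o(c)=4$ and $G(\alpha,\beta)_2$ is the generalized quaternion group of order $16$; (11) if $m=1$ and $n>2$, then $e=n+4$, $f=3$, $o(a)=o(c)=4$, $o(b)=2^{n+1}$; (12) if $m=1$ and $n=2$, then $e=7$, $f=4$, $o(a)=o(c)=4$, $o(b)=16$; (13) if $m>n=\ell>1$, then $e=m+4n$, $f=3$, $o(a)=2^{m+n}$, $o(b)=2^{2n}$, $o(c)=2^{n+1}$; (14) if $m=n>1$ and $\ell\ge2m$, then $e=7m-3$, $f=5$, $o(a)=o(b)=2^{3m-1}$, $o(c)=2^{2m}$; (15) if $m=n>1$ and $\ell=2m-1$, then $e=7m-3$, $f=5$, $o(a)=o(b)=2^{3m-1}$, $o(c)=2^{2m}$; (16) if $m=n\ge3$ and $\ell=2m-2$, then $e=7m-3$, $f=5$, $o(a)=o(b)=2^{3m-1}$,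 $o(c)=2^{2m-1}$; (17) if $m=n\ge5$, $2\ell+2=3m+1$ and $s=v_2(k^2-u^3)$, then $f=6$; if $s<(m-3)/2$, then $m\geq 7$, $e=(13m+2s-3)/2$, $o(a)=o(b)=2^{(5m+2s+1)/2}$, $o(c)=2^{2m+s}$; if $s\ge(m-3)/2$, then $e=7m-3$, $o(a)=o(b)=2^{3m-1}$, $o(c)=2^{(5m-3)/2}$; (18) if $m=n\ge3$, $2\ell+2>3m+1$ and $\ell\le2m-3$, then $e=5m+\ell-1$, $f=5$, $o(a)=o(b)=2^{\ell+m+1}$, $o(c)=2^{2m}$; (19) if $m=n\ge3$, $m<\ell<2m$, $2\ell+2\le3m$ and $\ell\le2m-3$, then $e=2m+3\ell$, $f=5$, $o(a)=o(b)=2^{\ell+m}$, $o(c)=2^{2\ell-m+1}$. -/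

import Mathlib

/-- The commutator `[x, y] = x⁻¹ y⁻¹ x y`. -/
def rcomm {T : Type*} [Group T] (x y : T) : T := x⁻¹ * y⁻¹ * x * y

/-- The conjugate `y ^ x = x⁻¹ y x`. -/
def rconj {T : Type*} [Group T] (y x : T) : T := x⁻¹ * y * x

/-- The relators of `⟨A, B | A ^ [A, B] = A ^ α, B ^ [B, A] = B ^ β⟩`, with `A`, `B` the free
generators indexed by `0`, `1`. -/
def macdonaldRels (α β : ℤ) : Set (FreeGroup (Fin 2)) :=
  let A : FreeGroup (Fin 2) := FreeGroup.of 0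
  let B : FreeGroup (Fin 2) := FreeGroup.of 1
  {rconj A (rcomm A B) * (A ^ α)⁻¹, rconj B (rcomm B A) * (B ^ β)⁻¹}

/-- The Macdonald group `G(α, β)`. -/
abbrev MacdonaldGroup (α β : ℤ) : Type := PresentedGroup (macdonaldRels α β)

/-- The generator `A` of `G(α, β)`. -/
def genA (α β : ℤ) : MacdonaldGroup α β := PresentedGroup.of 0

/-- The generator `B` of `G(α, β)`. -/
def genB (α β : ℤ) : MacdonaldGroup α β := PresentedGroup.of 1

/-- The element `C = [A, B]` of `G(α, β)`. -/
def genC (α β : ℤ) : MacdonaldGroup α β := rcomm (genA α β) (genB α β)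

/-- `π` is the canonical projection of `G` onto its Sylow `p`-subgroup `P`: a homomorphism
`G → P` that is the identity on `P`. In a finite nilpotent group, which is the direct product of
its Sylow subgroups, there is exactly one, because it has to kill the elements of order
prime to `p`. -/
def IsSylowProjection {G : Type*} [Group G] {p : ℕ} (P : Sylow p G) (π : G →* P) : Prop :=
  ∀ x : P, π (x : G) = x

/-- `v_p(γ - 1)`: this is `m` for `γ = α` and `n` for `γ = β`. -/
def valSubOne (p : ℕ) (γ : ℤ) : ℕ := padicValInt p (γ - 1)

/-- `ℓ = v_p(α - β)`, which is `∞` if `α = β`. -/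
noncomputable def valDiff (p : ℕ) (α β : ℤ) : ℕ∞ := emultiplicity (p : ℤ) (α - β)

/-- The prime-to-`p` part `x / p ^ v_p(x)` of a nonzero integer `x`. -/
def unitPart (p : ℕ) (x : ℤ) : ℤ := x / (p : ℤ) ^ padicValInt p x

/-- `s = v_p(2 k ^ 2 - u ^ 3)`, where `α = 1 + p ^ m u` and `α - β = p ^ ℓ k` with `p ∤ u, k`. -/
noncomputable def sOdd (p : ℕ) (α β : ℤ) : ℕ∞ :=
  emultiplicity (p : ℤ) (2 * unitPart p (α - β) ^ 2 - unitPart p (α - 1) ^ 3)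

/-- `s = v_2(k ^ 2 - u ^ 3)`, where `α = 1 + 2 ^ m u` and `α - β = 2 ^ ℓ k` with `u, k` odd. -/
noncomputable def sTwo (α β : ℤ) : ℕ∞ :=
  emultiplicity (2 : ℤ) (unitPart 2 (α - β) ^ 2 - unitPart 2 (α - 1) ^ 3)

/-- The parameters of `(α, β)` at `p` on which the structure of `G(α, β)_p` depends are preserved
when `(α, β)` is replaced by `(α₀, β₀)`. The parameter `s` only matters in the two cases below, and
there only up to the threshold `m / 2`, respectively `(m - 3) / 2`. -/
structure SameParameters (p : ℕ) (α β α₀ β₀ : ℤ) : Prop where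
  m_eq : valSubOne p α₀ = valSubOne p α
  n_eq : valSubOne p β₀ = valSubOne p β
  l_eq : valDiff p α₀ β₀ = valDiff p α β
  mod_left : p = 3 → α₀ ≡ α [ZMOD 27]
  mod_right : p = 3 → β₀ ≡ β [ZMOD 27]
  s_odd : p ≠ 2 → 0 < valSubOne p α → valSubOne p α = valSubOne p β →
    2 * valDiff p α β = 3 * (valSubOne p α : ℕ∞) →
    2 * sOdd p α β < valSubOne p α ∨ 2 * sOdd p α₀ β₀ < valSubOne p α →
    sOdd p α₀ β₀ = sOdd p α β
  s_two : p = 2 → 5 ≤ valSubOne p α → valSubOne p α = valSubOne p β →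
    2 * valDiff p α β + 2 = 3 * (valSubOne p α : ℕ∞) + 1 →
    2 * sTwo α β + 3 < valSubOne p α ∨ 2 * sTwo α₀ β₀ + 3 < valSubOne p α →
    sTwo α₀ β₀ = sTwo α β

/-- `e = v_p(|G(α, β)|)`, and `a, b, c`, the images of `A, B, C` under the canonical projection to
the Sylow `p`-subgroup, have orders `oa, ob, oc`. -/
def HasOrders (p : ℕ) (α β : ℤ) (e oa ob oc : ℕ) : Prop :=
  Finite (MacdonaldGroup α β) ∧ padicValNat p (Nat.card (MacdonaldGroup α β)) = e ∧
    ∀ P : Sylow p (MacdonaldGroup α β), ∃ π : MacdonaldGroup α β →* P, IsSylowProjection P π ∧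
      orderOf (π (genA α β)) = oa ∧ orderOf (π (genB α β)) = ob ∧ orderOf (π (genC α β)) = oc

/-- The Sylow `p`-subgroup of `G(α, β)` is nilpotent of class (exactly) `f`. -/
def HasClass (p : ℕ) (α β : ℤ) (f : ℕ) : Prop :=
  ∀ P : Sylow p (MacdonaldGroup α β), Group.IsNilpotent P ∧ Group.nilpotencyClass P = f

/-- `p > 3`, or `p = 3` and neither `α` nor `β` is `7` modulo `9`; moreover `m, n > 0`. -/
def GenericCase (p : ℕ) (α β : ℤ) : Prop :=
  0 < valSubOne p α ∧ 0 < valSubOne p β ∧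
    (3 < p ∨ p = 3 ∧ ¬ α ≡ 7 [ZMOD 9] ∧ ¬ β ≡ 7 [ZMOD 9])

/-- The assertion made by the `i`-th of the nineteen structure theorems, `1 ≤ i ≤ 19`, about the
prime `p` and the pair `(α, β)`. Throughout `m = v_p(α - 1)`, `n = v_p(β - 1)`, `l = v_p(α - β)`. -/
def StructureTheorem (p : ℕ) (α β : ℤ) (i : ℕ) : Prop :=
  let m := valSubOne p α
  let n := valSubOne p β
  let l := valDiff p α β
  match i with
  | 1 => GenericCase p α β → n ≤ m → l = n →
      HasOrders p α β (4 * n + m) (p ^ (m + n)) (p ^ (2 * n)) (p ^ n) ∧ HasClass p α β 3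
  | 2 => GenericCase p α β → m = n → 2 * m ≤ l →
      HasOrders p α β (7 * m) (p ^ (3 * m)) (p ^ (3 * m)) (p ^ (2 * m)) ∧ HasClass p α β 5
  | 3 => GenericCase p α β → m = n → ∀ d : ℕ, l = d → m < d → d < 2 * m → 2 * d < 3 * m →
      HasOrders p α β (2 * m + 3 * d) (p ^ (m + d)) (p ^ (m + d)) (p ^ (2 * d - m)) ∧
        HasClass p α β 5
  | 4 => GenericCase p α β → m = n → ∀ d : ℕ, l = d → m < d → d < 2 * m → 3 * m < 2 * d →
      HasOrders p α β (5 * m + d) (p ^ (m + d)) (p ^ (m + d)) (p ^ (2 * m)) ∧ HasClass p α β 5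
  | 5 => GenericCase p α β → m = n → 2 * l = 3 * (m : ℕ∞) →
      (sOdd p α β = 0 → HasClass p α β 5) ∧ (0 < sOdd p α β → HasClass p α β 6) ∧
      (∀ s : ℕ, sOdd p α β = s → 2 * s ≤ m →
        HasOrders p α β (s + 13 * m / 2) (p ^ (s + 5 * m / 2)) (p ^ (s + 5 * m / 2))
          (p ^ (2 * m + s))) ∧
      (m ≤ 2 * sOdd p α β →
        HasOrders p α β (7 * m) (p ^ (3 * m)) (p ^ (3 * m)) (p ^ (5 * m / 2)))
  | 6 => p = 3 → α ≡ 7 [ZMOD 9] → β ≡ 7 [ZMOD 9] → α ≡ β [ZMOD 27] →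
      HasOrders p α β 10 81 81 27 ∧ HasClass p α β 7
  | 7 => p = 3 → α ≡ 7 [ZMOD 9] → β ≡ 7 [ZMOD 9] → l = 2 →
      HasOrders p α β 8 27 27 9 ∧ HasClass p α β 5
  | 8 => p = 3 → α ≡ 7 [ZMOD 9] → β ≡ 4 [ZMOD 9] →
      HasOrders p α β 5 9 9 3 ∧ HasClass p α β 3
  | 9 => p = 3 → α ≡ 7 [ZMOD 9] → β ≡ 1 [ZMOD 9] →
      HasOrders p α β (n + 4) 9 (3 ^ (n + 1)) 3 ∧ HasClass p α β 3
  | 10 => p = 2 → m = 1 → n = 1 →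
      HasOrders p α β 4 4 4 4 ∧ HasClass p α β 3 ∧
        ∀ P : Sylow p (MacdonaldGroup α β), Nonempty (P ≃* QuaternionGroup 4)
  | 11 => p = 2 → m = 1 → 2 < n →
      HasOrders p α β (n + 4) 4 (2 ^ (n + 1)) 4 ∧ HasClass p α β 3
  | 12 => p = 2 → m = 1 → n = 2 →
      HasOrders p α β 7 4 16 4 ∧ HasClass p α β 4
  | 13 => p = 2 → 1 < n → n < m → l = n →
      HasOrders p α β (m + 4 * n) (2 ^ (m + n)) (2 ^ (2 * n)) (2 ^ (n + 1)) ∧ HasClass p α β 3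
  | 14 => p = 2 → 1 < m → m = n → 2 * m ≤ l →
      HasOrders p α β (7 * m - 3) (2 ^ (3 * m - 1)) (2 ^ (3 * m - 1)) (2 ^ (2 * m)) ∧
        HasClass p α β 5
  | 15 => p = 2 → 1 < m → m = n → l = (2 * m - 1 : ℕ) →
      HasOrders p α β (7 * m - 3) (2 ^ (3 * m - 1)) (2 ^ (3 * m - 1)) (2 ^ (2 * m)) ∧
        HasClass p α β 5
  | 16 => p = 2 → 3 ≤ m → m = n → l = (2 * m - 2 : ℕ) →
      HasOrders p α β (7 * m - 3) (2 ^ (3 * m - 1)) (2 ^ (3 * m - 1)) (2 ^ (2 * m - 1)) ∧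
        HasClass p α β 5
  | 17 => p = 2 → 5 ≤ m → m = n → 2 * l + 2 = 3 * (m : ℕ∞) + 1 →
      HasClass p α β 6 ∧
      (∀ s : ℕ, sTwo α β = s → 2 * s + 3 < m → 7 ≤ m ∧
        HasOrders p α β ((13 * m + 2 * s - 3) / 2) (2 ^ ((5 * m + 2 * s + 1) / 2))
          (2 ^ ((5 * m + 2 * s + 1) / 2)) (2 ^ (2 * m + s))) ∧
      (m ≤ 2 * sTwo α β + 3 →
        HasOrders p α β (7 * m - 3) (2 ^ (3 * m - 1)) (2 ^ (3 * m - 1)) (2 ^ ((5 * m - 3) / 2)))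
  | 18 => p = 2 → 3 ≤ m → m = n → ∀ d : ℕ, l = d → 3 * m + 1 < 2 * d + 2 → d + 3 ≤ 2 * m →
      HasOrders p α β (5 * m + d - 1) (2 ^ (d + m + 1)) (2 ^ (d + m + 1)) (2 ^ (2 * m)) ∧
        HasClass p α β 5
  | 19 => p = 2 → 3 ≤ m → m = n → ∀ d : ℕ, l = d → m < d → d < 2 * m → 2 * d + 2 ≤ 3 * m →
      d + 3 ≤ 2 * m →
      HasOrders p α β (2 * m + 3 * d) (2 ^ (d + m)) (2 ^ (d + m)) (2 ^ (2 * d - m + 1)) ∧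
        HasClass p α β 5
  | _ => True

/-! Take `α₀ = α + p ^ (k + 1) * t` and `β₀ = β + p ^ (k + 1) * t` with `t` positive and large and
`k` at least the exponent of `p` in `|G(α, β)|`. The common shift leaves `α - β` unchanged, so `ℓ`
and the unit `k` of the statement do not move, while `m`, `n`, the residues modulo 27 and `u` modulo
`p ^ (m + 1)` survive because the shift is `p`-adically small.

For the isomorphism of Sylow subgroups, `P` has exponent dividing `p ^ k`, so its generators also
satisfy the relations for `(α₀, β₀)`. No such bound is known in advance for `Q`, with generators `x,
y`. Factor out the normal closure `K` of `x ^ p ^ (k + 1)` and `y ^ p ^ (k + 1)`: there the two sets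
of relations agree, the quotient is an image of `P`, and so `x ^ p ^ k` and `y ^ p ^ k` lie in `K`,
the normal closure of their own `p`-th powers. In a finite `p`-group this forces them to be trivial
(`IsPGroup.eq_one_of_mem_normalClosure_pow`). The resulting maps between `P` and `Q` are mutually
inverse on generators.

This needs `G(α, β)` to be finite and nilpotent. Computing one conjugate in two ways
(`MacdonaldPair.key_identity`) shows that the generators are torsion. Then one inducts on a common
exponent `N`: for the largest prime `q` dividing `N`, suitable powers of `c`, `a` and `b` are
successively central, and killing them divides the exponent by `q`. -/

open Finset

/-! ### Power formulas when `c` conjugates `a` to a power of itself -/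

section Semidirect

variable {G : Type*} [Group G] {a b c : G} {α β : ℤ}

theorem conj_pow_of_conj (h : c⁻¹ * a * c = a ^ α) (i : ℕ) (k : ℤ) :
    (c ^ i)⁻¹ * a ^ k * c ^ i = a ^ (k * α ^ i) := by
  induction i generalizing k with
  | zero => simp
  | succ i ih =>
    have h1 : c⁻¹ * a ^ k * c = a ^ (α * k) := by
      have := conj_zpow (i := k) (a := c⁻¹) (b := a)
      rw [inv_inv, h, ← zpow_mul] at this
      exact this.symm
    have : (c ^ (i + 1))⁻¹ * a ^ k * c ^ (i + 1)
        = (c ^ i)⁻¹ * (c⁻¹ * a ^ k * c) * c ^ i := by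
      rw [pow_succ']; group
    rw [this, h1, ih]
    congr 1; ring

theorem zpow_mul_pow_of_conj (h : c⁻¹ * a * c = a ^ α) (i : ℕ) (k : ℤ) :
    a ^ k * c ^ i = c ^ i * a ^ (k * α ^ i) := by
  rw [← conj_pow_of_conj h]; group

theorem mul_pow_of_conj (h : c⁻¹ * a * c = a ^ α) (k : ℕ) :
    (c * a) ^ k = c ^ k * a ^ (∑ i ∈ range k, α ^ i) := by
  induction k with
  | zero => simp
  | succ k ih =>
    have h1 := zpow_mul_pow_of_conj h 1 (∑ i ∈ range k, α ^ i)
    rw [pow_one, pow_one] at h1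
    rw [pow_succ, ih, mul_assoc, ← mul_assoc _ c a, h1, mul_assoc, ← zpow_add_one,
      ← mul_assoc, ← pow_succ, sum_mul, sum_range_succ' (fun i => α ^ i)]
    simp [pow_succ]

theorem mul_pow_of_conj' (h : c⁻¹ * a * c = a ^ α) (k : ℕ) :
    (a * c) ^ k = c ^ k * a ^ (α * ∑ i ∈ range k, α ^ i) := by
  have h1 : a * c = c * a ^ α := by rw [← h]; group
  have h2 : c⁻¹ * a ^ α * c = (a ^ α) ^ α := by
    have := conj_pow_of_conj h 1 α
    simpa [zpow_mul] using this
  rw [h1, mul_pow_of_conj h2, zpow_mul]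

end Semidirect

/-! ### Consequences of the Macdonald relations -/

/-- The defining relations of the Macdonald group `G(α, β)`, for elements `a`, `b` of a group. -/
structure MacdonaldPair {G : Type*} [Group G] (α β : ℤ) (a b : G) : Prop where
  left : rconj a (rcomm a b) = a ^ α
  right : rconj b (rcomm b a) = b ^ β

namespace MacdonaldPair

variable {G : Type*} [Group G] {a b : G} {α β : ℤ}

theorem rcomm_inv (a b : G) : (rcomm a b)⁻¹ = rcomm b a := by
  unfold rcomm; group

theorem symm (h : MacdonaldPair α β a b) : MacdonaldPair β α b a := ⟨h.right, h.left⟩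

theorem map {H F : Type*} [Group H] [FunLike F G H] [MonoidHomClass F G H] (f : F)
    (h : MacdonaldPair α β a b) : MacdonaldPair α β (f a) (f b) := by
  constructor
  · have := congrArg f h.left
    simpa [rconj, rcomm] using this
  · have := congrArg f h.right
    simpa [rconj, rcomm] using this

theorem conj_left (h : MacdonaldPair α β a b) :
    (rcomm a b)⁻¹ * a * rcomm a b = a ^ α := h.left

theorem conj_right (h : MacdonaldPair α β a b) :
    ((rcomm a b)⁻¹)⁻¹ * b * (rcomm a b)⁻¹ = b ^ β := by
  rw [rcomm_inv]; exact h.right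

/-- Since `a ^ b = a * [a, b]`, conjugating `a ^ k` by `b` gives `(a * c) ^ k`, which the relation
for `a` lets one collect. -/
theorem pow_conj_gen (h : MacdonaldPair α β a b) (k : ℕ) :
    b⁻¹ * a ^ k * b = rcomm a b ^ k * a ^ (α * ∑ i ∈ range k, α ^ i) := by
  rw [← mul_pow_of_conj' h.conj_left]
  have := conj_pow (i := k) (a := b⁻¹) (b := a)
  rw [inv_inv] at this
  rw [← this]
  congr 1
  unfold rcomm; group

/-- Computing `a ^ (c ^ 2 * b)` in two ways, where `c = [a, b]`, relates powers of `a`, `b`, `c`. -/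
theorem key_identity (h : MacdonaldPair α β a b) {P Q : ℕ} (hP : (P : ℤ) = α ^ 2)
    (hQ : (Q : ℤ) = β ^ 2) :
    b ^ (Q * β ^ Q - β * ∑ i ∈ range Q, β ^ i) =
      rcomm a b ^ (2 + P) * a ^ (α * ∑ i ∈ range P, α ^ i - α ^ (2 + P)) *
        (rcomm a b ^ (2 + Q))⁻¹ := by
  have h1 := h.pow_conj_gen P
  have h2 := h.symm.pow_conj_gen Q
  rw [← rcomm_inv a b] at h2
  have h3 := conj_pow_of_conj h.conj_left 2 1
  have h4 := conj_pow_of_conj h.conj_right 2 1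
  have h5 := conj_pow_of_conj h.conj_right Q Q
  have h6 := conj_pow_of_conj h.conj_left (2 + P) (-1)
  set c := rcomm a b
  set s := α * ∑ i ∈ range P, α ^ i
  set t := β * ∑ i ∈ range Q, β ^ i
  rw [one_mul, ← hP, zpow_one, zpow_natCast] at h3
  rw [one_mul, ← hQ, zpow_one, zpow_natCast] at h4
  rw [zpow_natCast] at h5
  rw [sub_eq_neg_add, zpow_add, ← h5, sub_eq_neg_add s, zpow_add,
    show -α ^ (2 + P) = -1 * α ^ (2 + P) by ring, ← h6]
  rw [← h3] at h1
  have h7 : a⁻¹ * b ^ Q * a = (c ^ Q)⁻¹ * b ^ t := by rw [h2, inv_pow]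
  -- With `x = b ^ Q = c ^ 2 * b * c ^ (-2)`, both sides of the goal equal `[a, x] * c ^ (-Q)`.
  -- After the substitutions this is a word identity in `a`, `c`, `x`.
  have e1 : a ^ s = (c ^ P)⁻¹ * (b⁻¹ * ((c ^ 2)⁻¹ * a * c ^ 2) * b) := by rw [h1]; group
  have e2 : b ^ t = c ^ Q * (a⁻¹ * b ^ Q * a) := by rw [h7]; group
  have e3 : b = (c ^ 2)⁻¹ * b ^ Q * c ^ 2 := by rw [← h4]; group
  rw [zpow_neg, e2, e1]
  generalize hx : b ^ Q = x at *
  rw [e3, pow_add, pow_add]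
  simp only [inv_pow, inv_inv, zpow_neg, zpow_one]
  group

end MacdonaldPair

/-! ### The generators have finite order -/

theorem isOfFinOrder_of_zpow_eq_one {G : Type*} [Group G] {a : G} {k : ℤ} (hk : k ≠ 0)
    (h : a ^ k = 1) : IsOfFinOrder a :=
  isOfFinOrder_iff_zpow_eq_one.2 ⟨k, hk, h⟩

theorem isOfFinOrder_of_conj_pow {G : Type*} [Group G] {a c : G} {α : ℤ}
    (h : c⁻¹ * a * c = a ^ α) (hα : 2 ≤ |α|) (hc : IsOfFinOrder c) : IsOfFinOrder a := by
  obtain ⟨n, hn, hcn⟩ := isOfFinOrder_iff_pow_eq_one.1 hc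
  have h1 := conj_pow_of_conj h n 1
  simp only [hcn, zpow_one, inv_one, one_mul, mul_one] at h1
  refine isOfFinOrder_of_zpow_eq_one (k := α ^ n - 1) ?_ (by rw [zpow_sub_one, ← h1]; simp)
  intro h2
  have h3 : |α| ^ n = 1 := by rw [← abs_pow, sub_eq_zero.1 h2, abs_one]
  have := pow_eq_one_iff_of_nonneg (abs_nonneg α) hn.ne' |>.1 h3
  omega

/-- The sum is `1` modulo `α`, and `α` is not a unit. -/
theorem sum_pow_ne_of_two_le_abs {α x : ℤ} (hα : 2 ≤ |α|) {P : ℕ} (hP : P ≠ 0) :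
    ∑ i ∈ range P, α ^ i ≠ α * x := by
  intro h
  obtain ⟨k, rfl⟩ := Nat.exists_eq_succ_of_ne_zero hP
  rw [sum_range_succ'] at h
  have : α ∣ 1 := ⟨x - ∑ i ∈ range k, α ^ i, by
    rw [mul_sub, ← h, mul_sum]; simp [pow_succ']⟩
  rcases Int.isUnit_iff.1 (isUnit_of_dvd_one this) with h | h <;> rw [h] at hα <;> norm_num at hα

namespace MacdonaldPair

variable {G : Type*} [Group G] {a b : G} {α β : ℤ}

theorem eq_one_of_zero (h : MacdonaldPair α 0 a b) : b = 1 := by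
  have := h.right
  rw [rconj, zpow_zero] at this
  rw [mul_assoc, inv_mul_eq_one] at this
  exact mul_eq_right.1 this.symm

theorem zpow_eq_one_of_right_eq_one (h : MacdonaldPair α β a 1) : a ^ (α - 1) = 1 := by
  have := h.left
  simp only [rconj, rcomm] at this
  rw [zpow_sub_one, ← this]; simp

/-- For `2 ≤ |α|` and `|β| ≤ |α|`, a power of `[a, b]` is a power of `a` in a nontrivial way, and
a conjugate of a power of `b` lies in the subgroup generated by `a` and `[a, b]`. -/
theorem exists_rcomm_pow_eq_zpow (h : MacdonaldPair α β a b) (hα : 2 ≤ |α|)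
    (hβ0 : β ≠ 0) (hβα : |β| ≤ |α|) :
    ∃ (d Q P : ℕ) (w S T : ℤ), (Q : ℤ) = β ^ 2 ∧ (P : ℤ) = α ^ 2 ∧ P = Q + d ∧
      T = Q * β ^ Q - β * ∑ i ∈ range Q, β ^ i ∧
      rcomm a b ^ (d * (Q - 1)) = a ^ w ∧ w ≠ 0 ∧
      (rcomm a b ^ (2 + Q))⁻¹ * b ^ T * rcomm a b ^ (2 + Q) = rcomm a b ^ d * a ^ S := by
  have hP : ((α.natAbs ^ 2 : ℕ) : ℤ) = α ^ 2 := by simp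
  have hQ : ((β.natAbs ^ 2 : ℕ) : ℤ) = β ^ 2 := by simp
  have hQP : β.natAbs ^ 2 ≤ α.natAbs ^ 2 := Nat.pow_le_pow_left (by zify; exact hβα) 2
  have hQ0 : 0 < β.natAbs ^ 2 := by have := Int.natAbs_pos.2 hβ0; positivity
  generalize α.natAbs ^ 2 = P at *
  generalize β.natAbs ^ 2 = Q at *
  obtain ⟨d, rfl⟩ := Nat.exists_eq_add_of_le hQP
  have key := h.key_identity hP hQ
  set T := Q * β ^ Q - β * ∑ i ∈ range Q, β ^ i with hT
  set S := α * ∑ i ∈ range (Q + d), α ^ i - α ^ (2 + (Q + d)) with hS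
  have hS0 : S ≠ 0 := by
    have := sum_pow_ne_of_two_le_abs (x := α ^ (Q + d)) hα (by omega : Q + d ≠ 0)
    intro h0
    apply this
    have hα0 : α ≠ 0 := by rintro rfl; simp at hα
    apply mul_left_cancel₀ hα0
    rw [sub_eq_zero.1 h0]; ring
  have hr := h.conj_right
  have hl := h.conj_left
  set c := rcomm a b
  have hW : (c ^ (2 + Q))⁻¹ * b ^ T * c ^ (2 + Q) = c ^ d * a ^ S := by
    rw [key]; simp only [pow_add]; group
  -- Let `W = c ^ d * a ^ S`, a conjugate of `b ^ T` by a power of `c`. Conjugation by `c ^ (-2)`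
  -- raises `W` to the power `β ^ 2 = Q`, while conjugation by `c ^ 2` only changes `S` to `S * α ^
  -- 2`. Hence `W = (c ^ d * a ^ (S * α ^ 2)) ^ Q`, and expanding isolates a power of `c`.
  have e1 : c ^ 2 * b ^ T * (c ^ 2)⁻¹ = (b ^ T) ^ Q := by
    have := conj_pow_of_conj hr 2 T
    rw [inv_pow, inv_inv] at this
    rw [this, ← hQ, zpow_mul, zpow_natCast]
  have e2 : c ^ 2 * (c ^ d * a ^ S) * (c ^ 2)⁻¹ = (c ^ d * a ^ S) ^ Q := by
    rw [← hW]
    have : ((c ^ (2 + Q))⁻¹ * b ^ T * c ^ (2 + Q)) ^ Q =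
        (c ^ (2 + Q))⁻¹ * (b ^ T) ^ Q * c ^ (2 + Q) := by
      have := conj_pow (i := Q) (a := (c ^ (2 + Q))⁻¹) (b := b ^ T)
      rwa [inv_inv] at this
    rw [this, ← e1]; group
  have e3 : c ^ d * a ^ S = (c ^ d * a ^ (S * α ^ 2)) ^ Q := by
    have h1 : (c ^ d * a ^ (S * α ^ 2)) = (c ^ 2)⁻¹ * (c ^ d * a ^ S) * c ^ 2 := by
      rw [← conj_pow_of_conj hl]; group
    have := conj_pow (i := Q) (a := (c ^ 2)⁻¹) (b := c ^ d * a ^ S)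
    rw [inv_inv] at this
    rw [h1, this, ← e2]; group
  have hl' : (c ^ d)⁻¹ * a ^ (S * α ^ 2) * c ^ d = (a ^ (S * α ^ 2)) ^ (α ^ d) := by
    rw [conj_pow_of_conj hl, zpow_mul a (S * α ^ 2)]
  rw [mul_pow_of_conj hl', ← zpow_mul, ← pow_mul] at e3
  refine ⟨d, Q, Q + d, S - S * α ^ 2 * ∑ i ∈ range Q, (α ^ d) ^ i, S, T, hQ, hP, rfl, rfl, ?_,
    ?_, hW⟩
  · rw [zpow_sub]
    obtain ⟨q, rfl⟩ := Nat.exists_eq_succ_of_ne_zero hQ0.ne'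
    rw [eq_mul_inv_iff_mul_eq]
    apply mul_left_cancel (a := c ^ d)
    rw [e3, ← mul_assoc, ← pow_add]
    congr 2
    simp; ring
  · intro h0
    have h1 : S * (1 - α ^ 2 * ∑ i ∈ range Q, (α ^ d) ^ i) = 0 := by rw [← h0]; ring
    rcases mul_eq_zero.1 h1 with h2 | h2
    · exact hS0 h2
    · have : α ∣ 1 := ⟨α * ∑ i ∈ range Q, (α ^ d) ^ i, by linarith⟩
      rcases Int.isUnit_iff.1 (isUnit_of_dvd_one this) with h | h <;> rw [h] at hα <;>
        norm_num at hα

theorem isOfFinOrder_left_of_two_le (h : MacdonaldPair α β a b) (hα : 2 ≤ |α|) (hα1 : α ≠ 1)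
    (hβ0 : β ≠ 0) (hβα : |β| ≤ |α|) : IsOfFinOrder a := by
  obtain ⟨d, Q, P, w, S, T, -, -, -, -, h1, hw, -⟩ := h.exists_rcomm_pow_eq_zpow hα hβ0 hβα
  -- As a power of `c`, `a ^ w` commutes with `c`, yet `c` raises it to the power `α`.
  have h2 := conj_pow_of_conj h.conj_left 1 w
  rw [← h1, pow_one, pow_one] at h2
  refine isOfFinOrder_of_zpow_eq_one (k := w * (α - 1)) (mul_ne_zero hw (sub_ne_zero.2 hα1)) ?_
  rw [mul_sub, mul_one, zpow_sub, ← h2, ← h1, mul_assoc (rcomm a b)⁻¹, ← pow_succ, pow_succ']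
  group

theorem isOfFinOrder_right_of_two_le (h : MacdonaldPair α β a b) (hα : 2 ≤ |α|) (hα1 : α ≠ 1)
    (hβ : 2 ≤ |β|) (hβα : |β| ≤ |α|) : IsOfFinOrder b := by
  have hβ0 : β ≠ 0 := by rintro rfl; simp at hβ
  have ha := h.isOfFinOrder_left_of_two_le hα hα1 hβ0 hβα
  obtain ⟨d, Q, P, w, S, T, hQ, -, -, hT, h1, hw, h2⟩ := h.exists_rcomm_pow_eq_zpow hα hβ0 hβα
  have hQ2 : 2 ≤ Q := by
    have : (4 : ℤ) ≤ Q := by rw [hQ, ← sq_abs]; nlinarith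
    omega
  -- If `d = 0`, the relation between powers of `c` is void, but `b ^ T` is conjugate to `a ^ S`. If
  -- `d > 0`, then `c` is torsion, and with it `b`.
  rcases Nat.eq_zero_or_pos d with rfl | hd
  · have hT0 : T ≠ 0 := by
      have := sum_pow_ne_of_two_le_abs (x := Q * β ^ (Q - 2)) hβ (by omega : Q ≠ 0)
      intro h0
      apply this
      apply mul_left_cancel₀ hβ0
      rw [hT, sub_eq_zero] at h0
      rw [← h0]
      obtain ⟨k, rfl⟩ := Nat.exists_eq_add_of_le hQ2
      rw [Nat.add_sub_cancel_left]; ring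
    have h3 : IsOfFinOrder (b ^ T) := by
      have h4 : IsOfFinOrder (a ^ S) := ha.zpow
      rw [pow_zero, one_mul] at h2
      rw [← h2] at h4
      obtain ⟨n, hn, h5⟩ := isOfFinOrder_iff_pow_eq_one.1 h4
      refine isOfFinOrder_iff_pow_eq_one.2 ⟨n, hn, ?_⟩
      have := conj_pow (i := n) (a := (rcomm a b ^ (2 + Q))⁻¹) (b := b ^ T)
      rw [inv_inv, h5] at this
      have h6 := congrArg (fun x => rcomm a b ^ (2 + Q) * x * (rcomm a b ^ (2 + Q))⁻¹) this
      simp only [mul_assoc, mul_inv_cancel_left, mul_inv_cancel, mul_one] at h6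
      exact h6.symm
    obtain ⟨n, hn, h5⟩ := isOfFinOrder_iff_pow_eq_one.1 h3
    rw [← zpow_natCast, ← zpow_mul] at h5
    exact isOfFinOrder_of_zpow_eq_one (mul_ne_zero hT0 (by exact_mod_cast hn.ne')) h5
  · have hc : IsOfFinOrder (rcomm a b) := by
      have : IsOfFinOrder (rcomm a b ^ (d * (Q - 1))) := by rw [h1]; exact ha.zpow
      exact this.of_pow (by have : Q - 1 ≠ 0 := by omega
                            positivity)
    exact isOfFinOrder_of_conj_pow h.conj_right hβ hc.inv

theorem sq_conj_of_neg_one (h : MacdonaldPair α (-1) a b) :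
    a⁻¹ * b ^ 2 * a = (rcomm a b ^ 2)⁻¹ := by
  have := h.symm.pow_conj_gen 2
  rw [this, ← rcomm_inv a b]
  simp [sum_range_succ]

theorem isOfFinOrder_of_abs_le (h : MacdonaldPair α β a b) (hα : α ≠ 1) (hβ : β ≠ 1)
    (hβα : |β| ≤ |α|) : IsOfFinOrder a ∧ IsOfFinOrder b := by
  rcases eq_or_ne β 0 with rfl | hβ0
  · obtain rfl := h.eq_one_of_zero
    exact ⟨isOfFinOrder_of_zpow_eq_one (sub_ne_zero.2 hα) h.zpow_eq_one_of_right_eq_one,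
      IsOfFinOrder.one⟩
  have hα0 : α ≠ 0 := by rintro rfl; simp_all
  by_cases hα2 : 2 ≤ |α|
  · refine ⟨h.isOfFinOrder_left_of_two_le hα2 hα hβ0 hβα, ?_⟩
    by_cases hβ2 : 2 ≤ |β|
    · exact h.isOfFinOrder_right_of_two_le hα2 hα hβ2 hβα
    obtain rfl : β = -1 := by rcases abs_cases β <;> omega
    -- For `β = -1` one has `Q = 1`, which makes the exponent `d * (Q - 1)` useless. But `T = 0`, so
    -- `c ^ d * a ^ S = 1` shows that `c` is torsion.
    obtain ⟨d, Q, P, w, S, T, hQ, hP, hPQ, hT, -, -, h2⟩ := h.exists_rcomm_pow_eq_zpow hα2 hβ0 hβα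
    obtain rfl : Q = 1 := by norm_num at hQ; exact_mod_cast hQ
    have hT0 : T = 0 := by rw [hT]; simp
    have hd : 0 < d := by
      have : (4 : ℤ) ≤ P := by rw [hP, ← sq_abs]; nlinarith
      omega
    have hc : IsOfFinOrder (rcomm a b) := by
      rw [hT0, zpow_zero, mul_one, inv_mul_cancel] at h2
      have h3 : rcomm a b ^ d = a ^ (-S) := by rw [zpow_neg]; exact eq_inv_of_mul_eq_one_left h2.symm
      have : IsOfFinOrder (rcomm a b ^ d) := by
        rw [h3]; exact (h.isOfFinOrder_left_of_two_le hα2 hα hβ0 hβα).zpow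
      exact this.of_pow hd.ne'
    have h3 := h.sq_conj_of_neg_one
    have h4 : b ^ 2 = a * (rcomm a b ^ 2)⁻¹ * a⁻¹ := by rw [← h3]; group
    have h5 : IsOfFinOrder (b ^ 2) := by
      rw [h4]
      obtain ⟨n, hn, h5⟩ := isOfFinOrder_iff_pow_eq_one.1 hc
      refine isOfFinOrder_iff_pow_eq_one.2 ⟨n, hn, ?_⟩
      rw [conj_pow, inv_pow, ← pow_mul, mul_comm, pow_mul, h5]; simp
    exact h5.of_pow two_ne_zero
  · obtain rfl : α = -1 := by rcases abs_cases α <;> omega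
    obtain rfl : β = -1 := by rcases abs_cases β <;> rcases abs_cases (-1 : ℤ) <;> omega
    have h1 := h.sq_conj_of_neg_one
    have h2 := h.symm.sq_conj_of_neg_one
    have h3 := conj_pow_of_conj h.conj_left 2 1
    have h4 := conj_pow_of_conj h.conj_right 2 1
    rw [← rcomm_inv a b, inv_pow, inv_inv] at h2
    have h5 := conj_pow_of_conj h.conj_left 1 2
    have h6 := conj_pow_of_conj h.conj_right 1 2
    set c := rcomm a b
    simp only [zpow_one, one_mul, even_two, Even.neg_pow, one_pow, inv_pow, inv_inv] at h3 h4
    have ca : a * c ^ 2 = c ^ 2 * a := by nth_rw 2 [← h3]; group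
    have cb : c ^ 2 * b = b * c ^ 2 := by nth_rw 2 [← h4]; group
    have ea : a ^ 2 = c ^ 2 := by
      have : a ^ 2 = b * (b⁻¹ * a ^ 2 * b) * b⁻¹ := by group
      rw [this, h2, ← cb]; group
    have eb : b ^ 2 = (c ^ 2)⁻¹ := by
      have : b ^ 2 = a * (a⁻¹ * b ^ 2 * a) * a⁻¹ := by group
      rw [this, h1, mul_inv_eq_iff_eq_mul, mul_inv_eq_iff_eq_mul, mul_assoc, ca]; group
    have key : c ^ 2 = (c ^ 2)⁻¹ := by
      have h7 : c⁻¹ * a ^ (2 : ℤ) * c = a ^ (-2 : ℤ) := by simpa using h5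
      rw [zpow_neg, show (2 : ℤ) = (2 : ℕ) by rfl, zpow_natCast, ea] at h7
      rw [← h7]; group
    have c4 : c ^ 4 = 1 := by
      have : c ^ 4 = c ^ 2 * c ^ 2 := by group
      rw [this]; nth_rw 1 [key]; group
    constructor
    · refine isOfFinOrder_iff_pow_eq_one.2 ⟨4, by norm_num, ?_⟩
      rw [show 4 = 2 * 2 by rfl, pow_mul, ea, ← pow_mul, c4]
    · refine isOfFinOrder_iff_pow_eq_one.2 ⟨4, by norm_num, ?_⟩
      rw [show 4 = 2 * 2 by rfl, pow_mul, eb, inv_pow, ← pow_mul, c4, inv_one]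

theorem isOfFinOrder (h : MacdonaldPair α β a b) (hα : α ≠ 1) (hβ : β ≠ 1) :
    IsOfFinOrder a ∧ IsOfFinOrder b := by
  rcases le_total |β| |α| with h1 | h1
  · exact h.isOfFinOrder_of_abs_le hα hβ h1
  · exact (h.symm.isOfFinOrder_of_abs_le hβ hα h1).symm

end MacdonaldPair

/-! ### Finiteness and nilpotency by induction on a common exponent -/

theorem geom_sum_mul_range (x : ℤ) (m n : ℕ) :
    ∑ i ∈ range (m * n), x ^ i = (∑ i ∈ range m, x ^ i) * ∑ i ∈ range n, (x ^ m) ^ i := by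
  induction n with
  | zero => simp
  | succ n ih =>
    rw [Nat.mul_succ, sum_range_add, ih, sum_range_succ, mul_add, add_right_inj, sum_mul]
    exact sum_congr rfl fun i _ => by ring

/-- Induction on `k`: lengthening the sum by a factor `q` multiplies it by a geometric sum of `q`
terms with ratio `1` modulo `q`, which is `q` modulo `q ^ 2` because `q` is odd. -/
theorem geom_sum_sub_dvd {q : ℕ} (hq : Odd q) {α : ℤ} (hα : (q : ℤ) ∣ α - 1) (k j : ℕ) :
    (q : ℤ) ^ (k + 1) ∣ ∑ i ∈ range (q ^ k * j), α ^ i - (q ^ k * j : ℕ) := by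
  have h1 : ∀ i : ℕ, (q : ℤ) ∣ α ^ i - 1 := fun i => hα.trans (by simpa using sub_dvd_pow_sub_pow α 1 i)
  induction k with
  | zero =>
    have : ∑ i ∈ range (q ^ 0 * j), α ^ i - ((q ^ 0 * j : ℕ) : ℤ)
        = ∑ i ∈ range (q ^ 0 * j), (α ^ i - 1) := by simp
    rw [this, zero_add, pow_one]
    exact dvd_sum fun i _ => h1 i
  | succ k ih =>
    obtain ⟨z, hz⟩ := ih
    set J := q ^ k * j with hJ
    have e1 : q ^ (k + 1) * j = J * q := by rw [hJ]; ring
    rw [e1, geom_sum_mul_range]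
    obtain ⟨t, ht⟩ := h1 J
    obtain ⟨v, hv⟩ := odd_sq_dvd_geom_sum₂_sub (1 : ℤ) t hq
    have e2 : α ^ J = 1 + q * t := by linarith
    simp only [one_pow, mul_one, ← e2] at hv
    rw [sub_eq_iff_eq_add.1 hz, sub_eq_iff_eq_add.1 hv, hJ]
    push_cast
    exact ⟨z + v * (q * z + j), by ring⟩

/-- A prime dividing `φ(n)` divides `n` or some `r - 1` with `r` a prime factor of `n`. All such `r`
are below `q`, so `q` cannot occur. -/
theorem totient_eq_pow_mul {q k n : ℕ} (hq : q.Prime) (hn : n ≠ 0)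
    (hmax : ∀ r : ℕ, r.Prime → r ∣ n → r < q) :
    ∃ m, Nat.totient (q ^ (k + 1) * n) = q ^ k * m ∧ m.Coprime q ∧ m ≠ 0 := by
  have hqn : ¬ q ∣ n := fun h => (hmax q hq h).false
  have hcop : (q ^ (k + 1)).Coprime n := Nat.Coprime.pow_left _ ((Nat.Prime.coprime_iff_not_dvd hq).2 hqn)
  refine ⟨(q - 1) * n.totient, ?_, ?_, ?_⟩
  · rw [Nat.totient_mul hcop, Nat.totient_prime_pow_succ hq]; ring
  · refine Nat.Coprime.symm ((Nat.Prime.coprime_iff_not_dvd hq).2 fun h => ?_)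
    rcases hq.dvd_mul.1 h with h | h
    · have := Nat.le_of_dvd (by have := hq.two_le; omega) h
      have := hq.two_le
      omega
    · have h1 : q ∣ n * ∏ p ∈ n.primeFactors, (p - 1) := by
        rw [← Nat.totient_mul_prod_primeFactors]; exact h.mul_right _
      rcases hq.dvd_mul.1 h1 with h1 | h1
      · exact hqn h1
      · obtain ⟨r, hr, h2⟩ := (Prime.dvd_finsetProd_iff hq.prime _).1 h1
        have h3 := Nat.prime_of_mem_primeFactors hr
        have h4 := hmax r h3 (Nat.dvd_of_mem_primeFactors hr)
        have := Nat.le_of_dvd (by have := h3.two_le; omega) h2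
        omega
  · exact mul_ne_zero (by have := hq.two_le; omega) (Nat.totient_pos.2 (Nat.pos_of_ne_zero hn)).ne'

/-- In a cyclic group, the elements killed by a prime `q` form a group of order at most `q`,
generated by any nontrivial one. -/
theorem exists_zpow_eq_of_pow_prime_eq_one {G : Type*} [Group G] {a : G} {j e : ℤ} {q : ℕ}
    (hq : q.Prime) (hj : (a ^ j) ^ q = 1) (he : (a ^ e) ^ q = 1) (hx : a ^ j ≠ 1) :
    ∃ w : ℤ, a ^ e = (a ^ j) ^ w := by
  have hqp : Prime (q : ℤ) := Nat.prime_iff_prime_int.1 hq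
  have hq' : IsCoprime (q : ℤ) (orderOf a) → False := by
    intro h
    apply hx
    rw [← orderOf_dvd_iff_zpow_eq_one]
    rw [← zpow_natCast, ← zpow_mul, ← orderOf_dvd_iff_zpow_eq_one] at hj
    exact h.symm.dvd_of_dvd_mul_right hj
  have hqn : (q : ℤ) ∣ orderOf a := by
    by_contra h
    exact hq' ((Prime.coprime_iff_not_dvd hqp).2 h)
  obtain ⟨n, hn⟩ := hqn
  rw [← zpow_natCast, ← zpow_mul, ← orderOf_dvd_iff_zpow_eq_one, hn, mul_comm] at hj he
  have hq0 : (q : ℤ) ≠ 0 := hqp.ne_zero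
  obtain ⟨j', rfl⟩ := Int.dvd_of_mul_dvd_mul_right hq0 hj
  obtain ⟨e', rfl⟩ := Int.dvd_of_mul_dvd_mul_right hq0 he
  have hj' : ¬ (q : ℤ) ∣ j' := by
    rintro ⟨t, rfl⟩
    apply hx
    rw [← orderOf_dvd_iff_zpow_eq_one, hn]
    exact ⟨t, by ring⟩
  obtain ⟨u, v, huv⟩ := (Prime.coprime_iff_not_dvd hqp).2 hj'
  refine ⟨v * e', ?_⟩
  rw [← zpow_mul, ← mul_inv_eq_one, ← zpow_neg, ← zpow_add, ← orderOf_dvd_iff_zpow_eq_one, hn]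
  refine ⟨e' * u, ?_⟩
  linear_combination (-e' * n) * huv

theorem mem_center_of_closure_pair {G : Type*} [Group G] {a b z : G}
    (h : Subgroup.closure {a, b} = ⊤) (ha : Commute z a) (hb : Commute z b) :
    z ∈ Subgroup.center G := by
  have : (⊤ : Subgroup G) ≤ Subgroup.centralizer {z} := by
    rw [← h, Subgroup.closure_le]
    rintro x (rfl | rfl)
    · exact Subgroup.mem_centralizer_singleton_iff.2 ha.eq.symm
    · exact Subgroup.mem_centralizer_singleton_iff.2 hb.eq.symm
  refine Subgroup.mem_center_iff.2 fun g => ?_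
  exact Subgroup.mem_centralizer_singleton_iff.1 (this (Subgroup.mem_top g))

theorem closure_pair_map {G H : Type*} [Group G] [Group H] (f : G →* H)
    (hf : Function.Surjective f) {a b : G} (h : Subgroup.closure {a, b} = ⊤) :
    Subgroup.closure {f a, f b} = ⊤ := by
  rw [← Set.image_pair, ← MonoidHom.map_closure, h, Subgroup.map_top_of_surjective f hf]

/-- A group is finite and nilpotent if this is so modulo a central element of finite order. -/
theorem finite_nilpotent_of_central {G : Type*} [Group G] {z : G} (hz : z ∈ Subgroup.center G)
    (hfin : IsOfFinOrder z)
    (h : ∀ (N : Subgroup G) [N.Normal], z ∈ N → Finite (G ⧸ N) ∧ Group.IsNilpotent (G ⧸ N)) :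
    Finite G ∧ Group.IsNilpotent G := by
  have hle : Subgroup.zpowers z ≤ Subgroup.center G := by simpa using hz
  have : (Subgroup.zpowers z).Normal := ⟨fun x hx g => by
    rwa [Subgroup.mem_center_iff.1 (hle hx) g, mul_inv_cancel_right]⟩
  obtain ⟨h1, h2⟩ := h (Subgroup.zpowers z) (Subgroup.mem_zpowers z)
  have : Finite (Subgroup.zpowers z) := by
    exact Set.finite_coe_iff.2 (finite_zpowers.2 hfin)
  refine ⟨Finite.of_subgroup_quotient (Subgroup.zpowers z), ?_⟩
  exact Subgroup.isNilpotent_of_ker_le_center (QuotientGroup.mk' (Subgroup.zpowers z))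
    (by rwa [QuotientGroup.ker_mk'])

namespace MacdonaldPair

variable {G : Type*} [Group G] {a b : G} {α β : ℤ}

theorem isOfFinOrder_rcomm (h : MacdonaldPair α β a b) {N : ℕ} (hN : 0 < N) (ha : a ^ N = 1) :
    IsOfFinOrder (rcomm a b) := by
  have h1 := h.pow_conj_gen N
  rw [ha, mul_one, inv_mul_cancel] at h1
  have h2 := eq_inv_of_mul_eq_one_left h1.symm
  have h3 : IsOfFinOrder (rcomm a b ^ N) := by
    rw [h2]
    exact (isOfFinOrder_iff_pow_eq_one.2 ⟨N, hN, ha⟩ : IsOfFinOrder a).zpow.inv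
  exact h3.of_pow hN.ne'

/-- Since `c` has finite order, conjugation by `c` makes `α` a unit modulo the order of `a`, so
Euler's theorem applies. -/
theorem commute_totient (h : MacdonaldPair α β a b) {N : ℕ} (hN : 0 < N) (ha : a ^ N = 1) :
    Commute (rcomm a b ^ Nat.totient N) a := by
  obtain ⟨R, hR, hcR⟩ := isOfFinOrder_iff_pow_eq_one.1 (h.isOfFinOrder_rcomm hN ha)
  have h1 := conj_pow_of_conj h.conj_left R 1
  have h2 := conj_pow_of_conj h.conj_left (Nat.totient N) 1
  rw [hcR] at h1
  simp only [zpow_one, one_mul, inv_one, mul_one] at h1 h2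
  have h3 : ((orderOf a : ℕ) : ℤ) ∣ α ^ R - 1 := by
    rw [orderOf_dvd_iff_zpow_eq_one, zpow_sub_one, ← h1, mul_inv_cancel]
  have h4 : (α : ZMod (orderOf a)) ^ R = 1 := by
    have := (ZMod.intCast_zmod_eq_zero_iff_dvd (α ^ R - 1) (orderOf a)).2 h3
    push_cast at this
    exact sub_eq_zero.1 this
  obtain ⟨u, hu⟩ : IsUnit (α : ZMod (orderOf a)) := IsUnit.of_pow_eq_one h4 hR.ne'
  obtain ⟨t, ht⟩ := Nat.totient_dvd_of_dvd (orderOf_dvd_of_pow_eq_one ha)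
  have h5 : ((orderOf a : ℕ) : ℤ) ∣ α ^ Nat.totient N - 1 := by
    rw [← ZMod.intCast_zmod_eq_zero_iff_dvd]
    push_cast
    rw [← hu, ht, pow_mul, ← Units.val_pow_eq_pow_val, ZMod.pow_totient]
    simp
  have h6 : a ^ (α ^ Nat.totient N) = a := by
    rw [orderOf_dvd_iff_zpow_eq_one, zpow_sub_one, mul_inv_eq_one] at h5
    exact h5
  rw [h6, mul_assoc, inv_mul_eq_iff_eq_mul] at h2
  exact h2.symm

/-- Put `J = q ^ k * j`. Because `c ^ J = 1`, conjugation by `b` sends `x = a ^ J`, of order `1` or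
`q`, to a power `x ^ w`. It remains to see that `w` is `1` modulo `q`. -/
theorem commute_pow_of_rcomm_pow_eq_one (h : MacdonaldPair α β a b) {q k j n : ℕ}
    (hq : q.Prime) (hj : n ∣ j) (hn : n.Coprime q) (ha : a ^ (q ^ (k + 1) * n) = 1)
    (hc : rcomm a b ^ (q ^ k * j) = 1) : Commute (a ^ (q ^ k * j)) b := by
  have hqp : Prime (q : ℤ) := Nat.prime_iff_prime_int.1 hq
  obtain ⟨j', rfl⟩ := hj
  have h1 := h.pow_conj_gen (q ^ k * (n * j'))
  rw [hc, one_mul] at h1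
  set J := q ^ k * (n * j') with hJ
  set e := α * ∑ i ∈ range J, α ^ i with he
  have hx : (a ^ J) ^ q = 1 := by
    rw [← pow_mul, show J * q = q ^ (k + 1) * n * j' by rw [hJ]; ring, pow_mul, ha, one_pow]
  have hy : (a ^ e) ^ q = 1 := by
    rw [← h1]
    have := conj_pow (i := q) (a := b⁻¹) (b := a ^ J)
    rw [inv_inv] at this
    rw [this, hx]; simp
  by_cases hx1 : a ^ J = 1
  · rw [hx1]; exact Commute.one_left b
  have hy1 : a ^ e ≠ 1 := by
    rw [← h1]
    intro h2
    apply hx1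
    rw [mul_assoc, inv_mul_eq_one] at h2
    exact mul_eq_right.1 h2.symm
  rw [← zpow_natCast a J] at hx hx1
  obtain ⟨w, hw⟩ := exists_zpow_eq_of_pow_prime_eq_one hq hx hy hx1
  have := Fact.mk hq
  have hox : orderOf (a ^ (J : ℤ)) = q := orderOf_eq_prime hx hx1
  have hqw : ¬ (q : ℤ) ∣ w := by
    intro h2
    rw [← hox, orderOf_dvd_iff_zpow_eq_one] at h2
    exact hy1 (hw.trans h2)
  -- `c` centralizes the normal subgroup generated by `a ^ J`
  have hcomm1 : Commute ((a ^ (J : ℤ)) ^ w) (rcomm a b) := by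
    have e1 : rcomm a b = a⁻¹ * (b⁻¹ * a * b) := by unfold rcomm; group
    have e2 : Commute ((a ^ (J : ℤ)) ^ w) a :=
      (((Commute.refl a).zpow_left _).zpow_left _)
    have e3 : Commute ((a ^ (J : ℤ)) ^ w) (b⁻¹ * a * b) := by
      rw [← hw, ← h1]
      have : Commute (a ^ J) a := (Commute.refl a).pow_left J
      show _ = _
      calc b⁻¹ * a ^ J * b * (b⁻¹ * a * b) = b⁻¹ * (a ^ J * a) * b := by group
        _ = b⁻¹ * (a * a ^ J) * b := by rw [this.eq]
        _ = _ := by group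
    rw [e1]
    exact (e2.inv_right).mul_right e3
  obtain ⟨u, v, huv⟩ := (Prime.coprime_iff_not_dvd hqp).2 hqw
  have hcomm2 : Commute (a ^ (J : ℤ)) (rcomm a b) := by
    have : a ^ (J : ℤ) = ((a ^ (J : ℤ)) ^ w) ^ v := by
      rw [← zpow_mul (a ^ (J : ℤ)), mul_comm w, eq_sub_of_add_eq' huv, zpow_sub, zpow_one,
        mul_comm u, zpow_mul _ (q : ℤ), zpow_natCast _ q, hx, one_zpow, inv_one, mul_one]
    rw [this]
    exact hcomm1.zpow_left v
  -- Conjugation by `c` fixes `x` and raises it to the power `α`.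
  have hqα : (q : ℤ) ∣ α - 1 := by
    rw [← hox, orderOf_dvd_iff_zpow_eq_one, zpow_sub_one, mul_inv_eq_one]
    have h2 := conj_pow_of_conj h.conj_left 1 J
    rw [pow_one, pow_one, mul_assoc, hcomm2.eq, inv_mul_cancel_left, zpow_mul] at h2
    exact h2.symm
  have hw1 : (a ^ (J : ℤ)) ^ w = a ^ (J : ℤ) := by
    rw [← mul_inv_eq_one, ← zpow_sub_one, ← orderOf_dvd_iff_zpow_eq_one, hox]
    rcases hq.eq_two_or_odd' with rfl | hodd
    -- For `q = 2`, oddness of `w` is enough; the congruence used for odd `q` would fail.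
    · push_cast at hqw ⊢; omega
    · obtain ⟨z, hz⟩ := geom_sum_sub_dvd hodd hqα k (n * j')
      rw [← hJ] at hz
      -- Only `a ^ (q ^ (k + 1) * n)` is known to vanish, so exponents are compared after
      -- multiplying by `n`, which is prime to `q`.
      have h2 : (a ^ (J : ℤ)) ^ (w * n) = (a ^ (J : ℤ)) ^ (α * n) := by
        rw [zpow_mul, ← hw, ← zpow_mul, ← zpow_mul, he, sub_eq_iff_eq_add.1 hz]
        have : α * (q ^ (k + 1) * z + J) * n = (q ^ (k + 1) * n : ℕ) * (α * z) + J * (α * n) := by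
          push_cast; ring
        rw [this, zpow_add, zpow_mul, zpow_natCast, ha, one_zpow, one_mul]
      rw [← mul_inv_eq_one, ← zpow_sub, ← orderOf_dvd_iff_zpow_eq_one, hox, ← sub_mul] at h2
      have h3 : (q : ℤ) ∣ w - α := by
        refine (hqp.dvd_or_dvd h2).resolve_right fun h4 => ?_
        have h5 := Int.natCast_dvd_natCast.1 h4
        exact (Nat.Prime.coprime_iff_not_dvd hq).1 hn.symm h5
      have := dvd_add h3 hqα
      simpa using this
  rw [hw, hw1, zpow_natCast, mul_assoc, inv_mul_eq_iff_eq_mul] at h1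
  exact h1

end MacdonaldPair

universe v

theorem MacdonaldPair.finite_nilpotent_of_pow_eq_one {α β : ℤ} (N : ℕ) (hN : 0 < N) :
    ∀ {G : Type v} [Group G] {a b : G}, MacdonaldPair α β a b →
      Subgroup.closure {a, b} = ⊤ → a ^ N = 1 → b ^ N = 1 → Finite G ∧ Group.IsNilpotent G := by
  induction N using Nat.strong_induction_on with
  | _ N ih =>
  intro G _ a b h hgen ha hb
  rcases Nat.lt_or_ge N 2 with hN2 | hN2
  · obtain rfl : N = 1 := by omega
    rw [pow_one] at ha hb
    subst ha hb
    have : Subsingleton G := by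
      rw [← Subgroup.subsingleton_iff, ← subsingleton_iff_bot_eq_top, ← hgen]
      simp [Subgroup.closure_singleton_one]
    exact ⟨inferInstance, inferInstance⟩
  have hne : N.primeFactors.Nonempty := Nat.nonempty_primeFactors.2 (by omega)
  set q := N.primeFactors.max' hne with hqdef
  have hqmem : q ∈ N.primeFactors := Finset.max'_mem _ _
  have hq : q.Prime := Nat.prime_of_mem_primeFactors hqmem
  have hqN : q ∣ N := Nat.dvd_of_mem_primeFactors hqmem
  have hmax : ∀ r : ℕ, r.Prime → r ∣ N → r ≤ q := fun r hr hrN =>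
    Finset.le_max' _ _ (Nat.mem_primeFactors.2 ⟨hr, hrN, by omega⟩)
  clear_value q
  obtain ⟨k', n, hqn, hNe⟩ := Nat.exists_eq_pow_mul_and_not_dvd (n := N) (by omega) q hq.ne_one
  obtain ⟨k, rfl⟩ : ∃ k, k' = k + 1 := by
    refine Nat.exists_eq_succ_of_ne_zero ?_
    rintro rfl
    rw [pow_zero, one_mul] at hNe
    exact hqn (hNe ▸ hqN)
  have hn0 : n ≠ 0 := by rintro rfl; omega
  obtain ⟨m, hm, hmq, hm0⟩ := totient_eq_pow_mul (k := k) hq hn0 fun r hr hrn =>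
    lt_of_le_of_ne (hmax r hr (hNe ▸ hrn.mul_left _)) (by rintro rfl; exact hqn hrn)
  rw [← hNe] at hm
  have hnq : n.Coprime q := ((Nat.Prime.coprime_iff_not_dvd hq).2 hqn).symm
  have hca := h.commute_totient hN ha
  have hcb : Commute (rcomm a b ^ Nat.totient N) b := by
    have := h.symm.commute_totient hN hb
    rw [← rcomm_inv, inv_pow] at this
    exact Commute.inv_left_iff.1 this
  refine finite_nilpotent_of_central (mem_center_of_closure_pair hgen hca hcb)
    ((h.isOfFinOrder_rcomm hN ha).pow) fun K _ hcK => ?_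
  have h1 := h.map (QuotientGroup.mk' K)
  have hgen1 := closure_pair_map _ (QuotientGroup.mk'_surjective K) hgen
  have ha1 : (QuotientGroup.mk' K a) ^ N = 1 := by rw [← map_pow, ha, map_one]
  have hb1 : (QuotientGroup.mk' K b) ^ N = 1 := by rw [← map_pow, hb, map_one]
  have hc1 : rcomm (QuotientGroup.mk' K a) (QuotientGroup.mk' K b) ^ (q ^ k * (n * m)) = 1 := by
    have e : (QuotientGroup.mk' K) (rcomm a b ^ Nat.totient N) = 1 :=
      (QuotientGroup.eq_one_iff _).2 hcK
    rw [map_pow, hm] at e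
    have e2 : rcomm (QuotientGroup.mk' K a) (QuotientGroup.mk' K b)
        = QuotientGroup.mk' K (rcomm a b) := by simp [rcomm]
    rw [e2, show q ^ k * (n * m) = q ^ k * m * n by ring, pow_mul, e, one_pow]
  generalize (QuotientGroup.mk' K) a = a1 at *
  generalize (QuotientGroup.mk' K) b = b1 at *
  have hab := h1.commute_pow_of_rcomm_pow_eq_one hq (dvd_mul_right n m) hnq
    (by rw [← hNe]; exact ha1) hc1
  have hba := h1.symm.commute_pow_of_rcomm_pow_eq_one (k := k) hq (dvd_mul_right n m) hnq
    (by rw [← hNe]; exact hb1) (by rw [← rcomm_inv, inv_pow, hc1, inv_one])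
  refine finite_nilpotent_of_central
    (mem_center_of_closure_pair hgen1 ((Commute.refl a1).pow_left _) hab)
    ((isOfFinOrder_iff_pow_eq_one.2 ⟨N, hN, ha1⟩ : IsOfFinOrder a1).pow) fun K2 _ haK2 => ?_
  refine finite_nilpotent_of_central (z := QuotientGroup.mk' K2 (b1 ^ (q ^ k * (n * m))))
    (mem_center_of_closure_pair (closure_pair_map _ (QuotientGroup.mk'_surjective K2) hgen1)
      (hba.map (QuotientGroup.mk' K2)) (((Commute.refl b1).pow_left _).map (QuotientGroup.mk' K2)))
    ?_ fun K3 _ hbK3 => ?_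
  · exact MonoidHom.isOfFinOrder _
      ((isOfFinOrder_iff_pow_eq_one.2 ⟨N, hN, hb1⟩ : IsOfFinOrder b1).pow)
  set f := (QuotientGroup.mk' K3).comp (QuotientGroup.mk' K2) with hf
  have hfs : Function.Surjective f :=
    (QuotientGroup.mk'_surjective K3).comp (QuotientGroup.mk'_surjective K2)
  have hred : ∀ x, x ^ N = 1 → f (x ^ (q ^ k * (n * m))) = 1 → f x ^ (q ^ k * n) = 1 := by
    intro x hx hx2
    have e1 : f x ^ N = 1 := by rw [← map_pow, hx, map_one]
    rw [map_pow] at hx2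
    -- The exponent drops by exactly `q` because `m` is prime to `q`.
    have : q ^ k * n = Nat.gcd N (q ^ k * (n * m)) := by
      rw [hNe, show q ^ (k + 1) * n = q ^ k * n * q by ring,
        show q ^ k * (n * m) = q ^ k * n * m by ring, Nat.gcd_mul_left, hmq.symm.gcd_eq_one, mul_one]
    rw [this]
    exact pow_gcd_eq_one.2 ⟨e1, hx2⟩
  refine ih (q ^ k * n) ?_ ?_ (h1.map f) (closure_pair_map f hfs hgen1)
    (hred a1 ha1 ?_) (hred b1 hb1 ?_)
  · rw [hNe, pow_succ]
    have : 0 < q ^ k * n := Nat.mul_pos (pow_pos hq.pos _) (Nat.pos_of_ne_zero hn0)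
    nlinarith [hq.two_le]
  · exact Nat.mul_pos (pow_pos hq.pos _) (Nat.pos_of_ne_zero hn0)
  · rw [hf, MonoidHom.comp_apply, (QuotientGroup.eq_one_iff (N := K2) _).2 haK2 |> fun h => (h : QuotientGroup.mk' K2 _ = 1), map_one]
  · exact (QuotientGroup.eq_one_iff _).2 hbK3

theorem MacdonaldPair.finite_nilpotent {α β : ℤ} (hα : α ≠ 1) (hβ : β ≠ 1)
    {G : Type*} [Group G] {a b : G} (h : MacdonaldPair α β a b)
    (hgen : Subgroup.closure {a, b} = ⊤) : Finite G ∧ Group.IsNilpotent G := by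
  obtain ⟨ha, hb⟩ := h.isOfFinOrder hα hβ
  obtain ⟨m, hm, ham⟩ := isOfFinOrder_iff_pow_eq_one.1 ha
  obtain ⟨n, hn, hbn⟩ := isOfFinOrder_iff_pow_eq_one.1 hb
  refine MacdonaldPair.finite_nilpotent_of_pow_eq_one (m * n) (Nat.mul_pos hm hn) h hgen ?_ ?_
  · rw [pow_mul, ham, one_pow]
  · rw [mul_comm, pow_mul, hbn, one_pow]

/-! ### Sylow projections and finite `p`-groups -/

open scoped commutatorElement

/-- The coordinate at `P` in the product of the Sylow subgroups is injective on `P`, hence bijective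
there. Composing with the inverse of this automorphism makes it the identity on `P`. -/
theorem exists_isSylowProjection {G : Type*} [Group G] [Finite G] [Group.IsNilpotent G] {p : ℕ}
    [Fact p.Prime] (P : Sylow p G) : ∃ π : G →* P, IsSylowProjection P π := by
  by_cases hp : p ∈ (Nat.card G).primeFactors
  · have hnormal : ∀ {q : ℕ} [Fact q.Prime] (Q : Sylow q G), Q.Normal := fun Q => inferInstance
    let e := (Sylow.directProductOfNormal hnormal).symm
    let τ : G →* P :=
      ((Pi.evalMonoidHom (fun Q : Sylow p G => Q) P).comp
        (Pi.evalMonoidHom (fun q : (Nat.card G).primeFactors => ∀ Q : Sylow q G, Q) ⟨p, hp⟩)).comp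
        e.toMonoidHom
    have hinj : Function.Injective (τ.comp P.toSubgroup.subtype) := by
      rw [injective_iff_map_eq_one]
      intro x hx
      have h1 : e (x : G) = 1 := by
        funext ⟨q, hq⟩
        funext Q
        have hq' := Fact.mk (Nat.prime_of_mem_primeFactors hq)
        by_cases hqp : q = p
        · subst hqp
          have := Sylow.unique_of_normal P (hnormal P)
          obtain rfl : Q = P := Subsingleton.elim _ _
          exact hx
        · obtain ⟨k, hk⟩ := P.isPGroup' x
          obtain ⟨j, hj⟩ := Q.isPGroup' (e (x : G) ⟨q, hq⟩ Q)
          have h2 : (e (x : G) ⟨q, hq⟩ Q) ^ p ^ k = 1 := by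
            have : e (x : G) ^ p ^ k = 1 := by
              rw [← map_pow, ← Subgroup.coe_pow, hk, Subgroup.coe_one, map_one]
            exact congrFun (congrFun this ⟨q, hq⟩) Q
          have h3 := pow_gcd_eq_one.2 ⟨h2, hj⟩
          have hcop : (p ^ k).gcd (q ^ j) = 1 :=
            Nat.Coprime.pow _ _ ((Nat.coprime_primes Fact.out hq'.out).2 (Ne.symm hqp))
          rwa [hcop, pow_one] at h3
      have h2 : (x : G) = 1 := e.injective (by rw [h1, map_one])
      exact Subtype.ext h2
    let θ := MulEquiv.ofBijective _ (Finite.injective_iff_bijective.1 hinj)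
    exact ⟨θ.symm.toMonoidHom.comp τ, fun x => θ.symm_apply_apply x⟩
  · have hcard : Nat.card P = 1 := by
      rw [P.card_eq_multiplicity, Finsupp.notMem_support_iff.1 hp, pow_zero]
    have := (Nat.card_eq_one_iff_unique.1 hcard).1
    exact ⟨1, fun x => Subsingleton.elim _ _⟩

/-- The kernel of `π` has order equal to the index of `P`, prime to `p`, so every homomorphism to a
`p`-group factors through `π`. -/
theorem IsSylowProjection.map_eq {G H : Type*} [Group G] [Finite G] [Group H] {p : ℕ}
    [Fact p.Prime] {P : Sylow p G} {π : G →* P} (hπ : IsSylowProjection P π) (hH : IsPGroup p H)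
    (f : G →* H) (g : G) : f (π g) = f g := by
  have hsurj : Function.Surjective π := fun x => ⟨x, hπ x⟩
  have hcard : Nat.card π.ker = P.toSubgroup.index := by
    have h1 := Subgroup.card_mul_index π.ker
    have h2 := P.toSubgroup.card_mul_index
    rw [Subgroup.index_ker, MonoidHom.range_eq_top.2 hsurj, Subgroup.card_top] at h1
    rw [← h1, mul_comm] at h2
    exact (Nat.eq_of_mul_eq_mul_right (Nat.card_pos) h2).symm
  have hndvd : ¬ p ∣ Nat.card π.ker := by rw [hcard]; exact P.not_dvd_index
  have hker : g * (π g : G)⁻¹ ∈ π.ker := by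
    rw [MonoidHom.mem_ker, map_mul, map_inv, hπ, mul_inv_cancel]
  obtain ⟨k, hk⟩ := hH (f (g * (π g : G)⁻¹))
  have h1 : f (g * (π g : G)⁻¹) ^ Nat.card π.ker = 1 := by
    rw [← map_pow]
    have := pow_card_eq_one' (x := (⟨_, hker⟩ : π.ker))
    rw [Subtype.ext_iff, Subgroup.coe_pow] at this
    rw [this]; simp
  have h2 := pow_gcd_eq_one.2 ⟨hk, h1⟩
  have hcop : (p ^ k).gcd (Nat.card π.ker) = 1 :=
    Nat.Coprime.pow_left _ ((Nat.Prime.coprime_iff_not_dvd Fact.out).2 hndvd)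
  rw [hcop, pow_one, map_mul, map_inv, mul_inv_eq_one] at h2
  exact h2.symm

/-- In a finite `p`-group, elements lying in the normal closure of their own `p`-th powers are
trivial. -/
theorem IsPGroup.eq_one_of_mem_normalClosure_pow {H : Type*} [Group H] [Finite H] {p : ℕ}
    [hp : Fact p.Prime] (hH : IsPGroup p H) {x y : H}
    (hx : x ∈ Subgroup.normalClosure {x ^ p, y ^ p})
    (hy : y ∈ Subgroup.normalClosure {x ^ p, y ^ p}) : x = 1 ∧ y = 1 := by
  set L := Subgroup.normalClosure ({x, y} : Set H) with hL
  have hxL : x ∈ L := Subgroup.subset_normalClosure (by simp)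
  have hyL : y ∈ L := Subgroup.subset_normalClosure (by simp)
  set R := ⁅L, (⊤ : Subgroup H)⁆ with hR
  -- modulo `⁅L, H⁆`, the elements `x` and `y` are central
  have hcent : ∀ z ∈ L, QuotientGroup.mk' R z ∈ Subgroup.center (H ⧸ R) := by
    intro z hz
    refine Subgroup.mem_center_iff.2 fun g => ?_
    obtain ⟨g, rfl⟩ := QuotientGroup.mk'_surjective R g
    have : ⁅z, g⁆ ∈ R := Subgroup.commutator_mem_commutator hz (Subgroup.mem_top g)
    have h1 : QuotientGroup.mk' R ⁅z, g⁆ = 1 := (QuotientGroup.eq_one_iff _).2 this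
    rw [map_commutatorElement, commutatorElement_eq_one_iff_mul_comm] at h1
    exact h1.symm
  let _ : CommGroup (Subgroup.center (H ⧸ R)) :=
    { (inferInstance : Group (Subgroup.center (H ⧸ R))) with
      mul_comm := fun u v => Subtype.ext (Subgroup.mem_center_iff.1 v.2 u) }
  let X : Subgroup.center (H ⧸ R) := ⟨_, hcent x hxL⟩
  let Y : Subgroup.center (H ⧸ R) := ⟨_, hcent y hyL⟩
  have hle : Subgroup.normalClosure {x ^ p, y ^ p} ≤
      (((Subgroup.closure {X, Y}).map (powMonoidHom p : Subgroup.center (H ⧸ R) →* Subgroup.center (H ⧸ R))).map (Subgroup.center (H ⧸ R)).subtype).comap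
        (QuotientGroup.mk' R) := by
    have hn : ((((Subgroup.closure {X, Y}).map (powMonoidHom p : Subgroup.center (H ⧸ R) →* Subgroup.center (H ⧸ R))).map
        (Subgroup.center (H ⧸ R)).subtype).comap (QuotientGroup.mk' R)).Normal := by
      refine Subgroup.Normal.comap ⟨?_⟩ _
      rintro _ ⟨z, hz, rfl⟩ g
      have : g * (z : H ⧸ R) * g⁻¹ = z := by
        rw [Subgroup.mem_center_iff.1 z.2 g, mul_inv_cancel_right]
      rw [Subgroup.subtype_apply, this]
      exact ⟨z, hz, rfl⟩
    refine Subgroup.normalClosure_le_normal ?_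
    rintro _ (rfl | rfl)
    · exact ⟨X ^ p, ⟨X, Subgroup.subset_closure (by simp), rfl⟩, by simp [X]⟩
    · exact ⟨Y ^ p, ⟨Y, Subgroup.subset_closure (by simp), rfl⟩, by simp [Y]⟩
  have hX : ∃ W ∈ Subgroup.closure {X, Y}, W ^ p = X := by
    obtain ⟨z, ⟨W, hW, hWz⟩, hz⟩ := hle hx
    exact ⟨W, hW, hWz.trans (Subtype.ext hz)⟩
  have hY : ∃ W ∈ Subgroup.closure {X, Y}, W ^ p = Y := by
    obtain ⟨z, ⟨W, hW, hWz⟩, hz⟩ := hle hy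
    exact ⟨W, hW, hWz.trans (Subtype.ext hz)⟩
  -- `X` and `Y` are `p`-th powers within the abelian group they generate, so that group is
  -- `p`-divisible. Being of `p`-power exponent, it is trivial.
  have hpow : ∀ k : ℕ, Subgroup.closure {X, Y} ≤ (powMonoidHom (p ^ k) : Subgroup.center (H ⧸ R) →* Subgroup.center (H ⧸ R)).range := by
    intro k
    induction k with
    | zero => intro z _; exact ⟨z, by simp⟩
    | succ k ih =>
      rw [Subgroup.closure_le]
      rintro _ (rfl | rfl)
      · obtain ⟨W, hW, h1⟩ := hX
        obtain ⟨V, hV⟩ := ih hW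
        exact ⟨V, by rw [← h1, ← hV]; simp [pow_succ, pow_mul]⟩
      · obtain ⟨W, hW, h1⟩ := hY
        obtain ⟨V, hV⟩ := ih hW
        exact ⟨V, by rw [← h1, ← hV]; simp [pow_succ, pow_mul]⟩
  obtain ⟨n, hn⟩ := hH.exists_card_eq
  have hZ : ∀ z : Subgroup.center (H ⧸ R), z ^ p ^ n = 1 := by
    intro z
    obtain ⟨g, hg⟩ := QuotientGroup.mk'_surjective R (z : H ⧸ R)
    refine Subtype.ext ?_
    rw [Subgroup.coe_pow, ← hg, ← map_pow, ← hn, pow_card_eq_one', map_one, Subgroup.coe_one]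
  have hone : ∀ z ∈ Subgroup.closure {X, Y}, z = 1 := by
    intro z hz
    obtain ⟨W, rfl⟩ := hpow n hz
    exact hZ W
  have hxR : x ∈ R := by
    have := hone X (Subgroup.subset_closure (by simp))
    exact (QuotientGroup.eq_one_iff _).1 (congrArg Subtype.val this)
  have hyR : y ∈ R := by
    have := hone Y (Subgroup.subset_closure (by simp))
    exact (QuotientGroup.eq_one_iff _).1 (congrArg Subtype.val this)
  have hLR : L ≤ R := by
    refine Subgroup.normalClosure_le_normal ?_
    rintro _ (rfl | rfl)
    · exact hxR
    · exact hyR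
  -- From `L ≤ ⁅L, H⁆` it follows that `L` lies in every term of the lower central series.
  have hLn : ∀ n, L ≤ (⊤ : Subgroup H).lowerCentralSeries n := by
    intro n
    induction n with
    | zero => exact le_top
    | succ n ih => exact hLR.trans (Subgroup.commutator_mono ih le_rfl)
  have hnil : Group.IsNilpotent H := hH.isNilpotent
  obtain ⟨n, hn⟩ := Subgroup.nilpotent_iff_lowerCentralSeries.1 hnil
  have hbot : L = ⊥ := le_bot_iff.1 (hn ▸ hLn n)
  rw [hbot, Subgroup.mem_bot] at hxL hyL
  exact ⟨hxL, hyL⟩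

/-! ### Comparing Sylow subgroups for nearby parameters -/

theorem macdonaldPair_gen (α β : ℤ) : MacdonaldPair α β (genA α β) (genB α β) := by
  have key : ∀ r ∈ macdonaldRels α β, PresentedGroup.mk (macdonaldRels α β) r = 1 := fun r hr =>
    PresentedGroup.one_of_mem hr
  constructor
  · have := key _ (Or.inl rfl)
    simp only [rconj, rcomm, map_mul, map_inv, map_zpow, mul_inv_eq_one] at this
    exact this
  · have := key _ (Or.inr rfl)
    simp only [rconj, rcomm, map_mul, map_inv, map_zpow, mul_inv_eq_one] at this
    exact this

theorem closure_gen (α β : ℤ) : Subgroup.closure {genA α β, genB α β} = ⊤ := by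
  rw [← PresentedGroup.closure_range_of (macdonaldRels α β)]
  congr 1
  ext x
  simp [genA, genB, Fin.exists_fin_two, eq_comm]

theorem MacdonaldPair.exists_lift {H : Type*} [Group H] {α β : ℤ} {x y : H}
    (h : MacdonaldPair α β x y) :
    ∃ f : MacdonaldGroup α β →* H, f (genA α β) = x ∧ f (genB α β) = y := by
  have hr : ∀ r ∈ macdonaldRels α β, FreeGroup.lift ![x, y] r = 1 := by
    rintro r (rfl | rfl)
    · have := h.left
      simpa [rconj, rcomm, mul_inv_eq_one] using this
    · have := h.right
      simpa [rconj, rcomm, mul_inv_eq_one] using this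
  exact ⟨PresentedGroup.toGroup hr, by simp [genA], by simp [genB]⟩

theorem macdonaldGroup_finite_nilpotent {α β : ℤ} (hα : α ≠ 1) (hβ : β ≠ 1) :
    Finite (MacdonaldGroup α β) ∧ Group.IsNilpotent (MacdonaldGroup α β) :=
  (macdonaldPair_gen α β).finite_nilpotent hα hβ (closure_gen α β)

theorem zpow_eq_zpow_of_dvd_sub {G : Type*} [Group G] {x : G} {n : ℕ} {α γ : ℤ}
    (hx : x ^ n = 1) (h : (n : ℤ) ∣ γ - α) : x ^ γ = x ^ α := by
  obtain ⟨t, ht⟩ := h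
  rw [eq_add_of_sub_eq' ht, zpow_add, zpow_mul, zpow_natCast, hx, one_zpow, mul_one]

theorem MacdonaldPair.congr {G : Type*} [Group G] {x y : G} {n : ℕ} {α β α₀ β₀ : ℤ}
    (h : MacdonaldPair α β x y) (hx : x ^ n = 1) (hy : y ^ n = 1) (hα : (n : ℤ) ∣ α - α₀)
    (hβ : (n : ℤ) ∣ β - β₀) : MacdonaldPair α₀ β₀ x y :=
  ⟨by rw [h.left, zpow_eq_zpow_of_dvd_sub hx hα], by rw [h.right, zpow_eq_zpow_of_dvd_sub hy hβ]⟩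

/-- The Sylow `p`-subgroups of `G(α, β)` and `G(α₀, β₀)` are isomorphic by a map that respects
the images of the generators. -/
def SylowEquivalent (p : ℕ) (α β α₀ β₀ : ℤ) : Prop :=
  ∀ (P : Sylow p (MacdonaldGroup α β)) (Q : Sylow p (MacdonaldGroup α₀ β₀))
    (π : MacdonaldGroup α β →* P) (ρ : MacdonaldGroup α₀ β₀ →* Q),
    IsSylowProjection P π → IsSylowProjection Q ρ →
    ∃ φ : P ≃* Q, φ (π (genA α β)) = ρ (genA α₀ β₀) ∧ φ (π (genB α β)) = ρ (genB α₀ β₀)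

theorem SylowEquivalent.symm {p : ℕ} {α β α₀ β₀ : ℤ} (h : SylowEquivalent p α β α₀ β₀) :
    SylowEquivalent p α₀ β₀ α β := by
  intro P Q π ρ hπ hρ
  obtain ⟨φ, hA, hB⟩ := h Q P ρ π hρ hπ
  exact ⟨φ.symm, by rw [← hA, φ.symm_apply_apply], by rw [← hB, φ.symm_apply_apply]⟩

section Sylow

variable {α β α₀ β₀ : ℤ} {p : ℕ} [Fact p.Prime]

/-- A bound for the orders of the generators of the Sylow `p`-subgroup of `G(α, β)` carries over
to all `p`-groups satisfying the relations of a pair of parameters close to `(α, β)`. -/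
theorem pow_eq_one_of_isSylowProjection [Finite (MacdonaldGroup α β)]
    {P : Sylow p (MacdonaldGroup α β)} {π : MacdonaldGroup α β →* P} (hπ : IsSylowProjection P π)
    {k : ℕ} (hA : π (genA α β) ^ p ^ k = 1) (hB : π (genB α β) ^ p ^ k = 1)
    {H : Type*} [Group H] [Finite H] (hH : IsPGroup p H) {x y : H}
    (h : MacdonaldPair α₀ β₀ x y) (hα : ((p ^ (k + 1) : ℕ) : ℤ) ∣ α₀ - α)
    (hβ : ((p ^ (k + 1) : ℕ) : ℤ) ∣ β₀ - β) : x ^ p ^ k = 1 ∧ y ^ p ^ k = 1 := by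
  set K := Subgroup.normalClosure {(x ^ p ^ k) ^ p, (y ^ p ^ k) ^ p} with hK
  have hmem : ∀ z, QuotientGroup.mk' K z = 1 ↔ z ∈ K := fun z => QuotientGroup.eq_one_iff z
  have hx : QuotientGroup.mk' K x ^ p ^ (k + 1) = 1 := by
    rw [← map_pow, hmem, pow_succ, pow_mul]
    exact Subgroup.subset_normalClosure (by simp)
  have hy : QuotientGroup.mk' K y ^ p ^ (k + 1) = 1 := by
    rw [← map_pow, hmem, pow_succ, pow_mul]
    exact Subgroup.subset_normalClosure (by simp)
  obtain ⟨f, hfA, hfB⟩ := ((h.map (QuotientGroup.mk' K)).congr hx hy hα hβ).exists_lift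
  have hHK : IsPGroup p (H ⧸ K) := hH.to_quotient K
  have h1 : x ^ p ^ k ∈ K := by
    rw [← hmem, map_pow, ← hfA, ← hπ.map_eq hHK f, ← map_pow, ← Subgroup.coe_pow, hA]; simp
  have h2 : y ^ p ^ k ∈ K := by
    rw [← hmem, map_pow, ← hfB, ← hπ.map_eq hHK f, ← map_pow, ← Subgroup.coe_pow, hB]; simp
  exact hH.eq_one_of_mem_normalClosure_pow h1 h2

/-- The order of `P` bounds its exponent, and `pow_eq_one_of_isSylowProjection` carries the bound
over to the generators of `Q`. Each pair of generators then satisfies both sets of relations. -/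
theorem sylowEquivalent_of_dvd (hα1 : α ≠ 1) (hβ1 : β ≠ 1) (hα₀1 : α₀ ≠ 1) (hβ₀1 : β₀ ≠ 1) {k : ℕ}
    (hk : (Nat.card (MacdonaldGroup α β)).factorization p ≤ k)
    (hα : ((p ^ (k + 1) : ℕ) : ℤ) ∣ α₀ - α) (hβ : ((p ^ (k + 1) : ℕ) : ℤ) ∣ β₀ - β) :
    SylowEquivalent p α β α₀ β₀ := by
  intro P Q π ρ hπ hρ
  have hG := (macdonaldGroup_finite_nilpotent hα1 hβ1).1
  have hG₀ := (macdonaldGroup_finite_nilpotent hα₀1 hβ₀1).1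
  have hP : ∀ x : P, x ^ p ^ k = 1 := fun x => by
    obtain ⟨j, rfl⟩ := Nat.exists_eq_add_of_le hk
    rw [pow_add, pow_mul, ← P.card_eq_multiplicity]
    exact (congrArg (· ^ p ^ j) pow_card_eq_one').trans (one_pow _)
  have hpair := (macdonaldPair_gen α β).map π
  have hpair₀ := (macdonaldPair_gen α₀ β₀).map ρ
  obtain ⟨hA₀, hB₀⟩ := pow_eq_one_of_isSylowProjection hπ (hP _) (hP _) Q.isPGroup' hpair₀ hα hβ
  have hsucc : ∀ {K : Type} [Group K] (x : K), x ^ p ^ k = 1 → x ^ p ^ (k + 1) = 1 := by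
    intro K _ x hx
    rw [pow_succ, pow_mul, hx, one_pow]
  obtain ⟨f, hfA, hfB⟩ := (hpair₀.congr (hsucc _ hA₀) (hsucc _ hB₀) hα hβ).exists_lift
  obtain ⟨g, hgA, hgB⟩ := (hpair.congr (hsucc _ (hP _)) (hsucc _ (hP _))
    ((dvd_sub_comm).1 hα) ((dvd_sub_comm).1 hβ)).exists_lift
  have hf := hπ.map_eq Q.isPGroup' f
  have hg := hρ.map_eq P.isPGroup' g
  have hgf : ∀ z, g (f z) = π z := by
    have : (g.comp Q.toSubgroup.subtype).comp f = π := by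
      refine MonoidHom.eq_of_eqOn_dense (closure_gen α β) ?_
      rintro _ (rfl | rfl)
      · simp [hfA, hg, hgA]
      · simp [hfB, hg, hgB]
    exact fun z => DFunLike.congr_fun this z
  have hfg : ∀ z, f (g z) = ρ z := by
    have : (f.comp P.toSubgroup.subtype).comp g = ρ := by
      refine MonoidHom.eq_of_eqOn_dense (closure_gen α₀ β₀) ?_
      rintro _ (rfl | rfl)
      · simp [hgA, hf, hfA]
      · simp [hgB, hf, hfB]
    exact fun z => DFunLike.congr_fun this z
  refine ⟨MonoidHom.toMulEquiv (f.comp P.toSubgroup.subtype) (g.comp Q.toSubgroup.subtype) ?_ ?_,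
    ?_, ?_⟩
  · ext z; simp [hgf, hπ z]
  · ext z; simp [hfg, hρ z]
  · exact (hf _).trans hfA
  · exact (hf _).trans hfB

theorem SylowEquivalent.exists_mulEquiv (h : SylowEquivalent p α β α₀ β₀) (hα1 : α ≠ 1)
    (hβ1 : β ≠ 1) (hα₀1 : α₀ ≠ 1) (hβ₀1 : β₀ ≠ 1) (P : Sylow p (MacdonaldGroup α β))
    (Q : Sylow p (MacdonaldGroup α₀ β₀)) :
    ∃ (π : MacdonaldGroup α β →* P) (ρ : MacdonaldGroup α₀ β₀ →* Q) (φ : P ≃* Q),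
      IsSylowProjection P π ∧ IsSylowProjection Q ρ ∧
      φ (π (genA α β)) = ρ (genA α₀ β₀) ∧ φ (π (genB α β)) = ρ (genB α₀ β₀) := by
  obtain ⟨_, _⟩ := macdonaldGroup_finite_nilpotent hα1 hβ1
  obtain ⟨_, _⟩ := macdonaldGroup_finite_nilpotent hα₀1 hβ₀1
  obtain ⟨π, hπ⟩ := exists_isSylowProjection P
  obtain ⟨ρ, hρ⟩ := exists_isSylowProjection Q
  obtain ⟨φ, hφ⟩ := h P Q π ρ hπ hρ
  exact ⟨π, ρ, φ, hπ, hρ, hφ⟩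

theorem SylowEquivalent.hasOrders (h : SylowEquivalent p α β α₀ β₀) (hα1 : α ≠ 1)
    (hβ1 : β ≠ 1) (hα₀1 : α₀ ≠ 1) (hβ₀1 : β₀ ≠ 1) {e oa ob oc : ℕ}
    (ho : HasOrders p α β e oa ob oc) : HasOrders p α₀ β₀ e oa ob oc := by
  obtain ⟨hfin, hcard, ho⟩ := ho
  obtain ⟨_, _⟩ := macdonaldGroup_finite_nilpotent hα₀1 hβ₀1
  have hp : p.Prime := Fact.out
  refine ⟨inferInstance, ?_, fun Q => ?_⟩
  · obtain ⟨P⟩ : Nonempty (Sylow p (MacdonaldGroup α β)) := inferInstance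
    obtain ⟨Q⟩ : Nonempty (Sylow p (MacdonaldGroup α₀ β₀)) := inferInstance
    obtain ⟨π, ρ, φ, -⟩ := h.exists_mulEquiv hα1 hβ1 hα₀1 hβ₀1 P Q
    rw [← hcard, ← Nat.factorization_def _ hp, ← Nat.factorization_def _ hp]
    apply Nat.pow_right_injective hp.two_le
    show p ^ _ = p ^ _
    rw [← P.card_eq_multiplicity, ← Q.card_eq_multiplicity]
    exact (Nat.card_congr φ.toEquiv).symm
  · obtain ⟨P⟩ : Nonempty (Sylow p (MacdonaldGroup α β)) := inferInstance
    obtain ⟨π, hπ, hA, hB, hC⟩ := ho P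
    obtain ⟨ρ, hρ⟩ := exists_isSylowProjection Q
    obtain ⟨φ, hφA, hφB⟩ := h P Q π ρ hπ hρ
    refine ⟨ρ, hρ, ?_, ?_, ?_⟩
    · rw [← hφA, φ.orderOf_eq, hA]
    · rw [← hφB, φ.orderOf_eq, hB]
    · have : φ (π (genC α β)) = ρ (genC α₀ β₀) := by
        simp only [genC, rcomm, map_mul, map_inv, hφA, hφB]
      rw [← this, φ.orderOf_eq, hC]

theorem nilpotencyClass_congr {G H : Type*} [Group G] [Group H] [Group.IsNilpotent G]
    [Group.IsNilpotent H] (φ : G ≃* H) : Group.nilpotencyClass G = Group.nilpotencyClass H :=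
  le_antisymm (Group.nilpotencyClass_le_of_surjective φ.symm.toMonoidHom φ.symm.surjective)
    (Group.nilpotencyClass_le_of_surjective φ.toMonoidHom φ.surjective)

theorem SylowEquivalent.hasClass (h : SylowEquivalent p α β α₀ β₀) (hα1 : α ≠ 1)
    (hβ1 : β ≠ 1) (hα₀1 : α₀ ≠ 1) (hβ₀1 : β₀ ≠ 1) {f : ℕ}
    (ho : HasClass p α β f) : HasClass p α₀ β₀ f := by
  intro Q
  obtain ⟨P⟩ : Nonempty (Sylow p (MacdonaldGroup α β)) := inferInstance
  obtain ⟨π, ρ, φ, -⟩ := h.exists_mulEquiv hα1 hβ1 hα₀1 hβ₀1 P Q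
  obtain ⟨h1, h2⟩ := ho P
  have := (Group.isNilpotent_congr φ).1 h1
  exact ⟨this, by rw [← h2, nilpotencyClass_congr φ]⟩

theorem SylowEquivalent.quaternion (h : SylowEquivalent p α β α₀ β₀) (hα1 : α ≠ 1)
    (hβ1 : β ≠ 1) (hα₀1 : α₀ ≠ 1) (hβ₀1 : β₀ ≠ 1) {K : Type*} [Group K]
    (ho : ∀ P : Sylow p (MacdonaldGroup α β), Nonempty (P ≃* K)) :
    ∀ Q : Sylow p (MacdonaldGroup α₀ β₀), Nonempty (Q ≃* K) := by
  intro Q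
  obtain ⟨P⟩ : Nonempty (Sylow p (MacdonaldGroup α β)) := inferInstance
  obtain ⟨π, ρ, φ, -⟩ := h.exists_mulEquiv hα1 hβ1 hα₀1 hβ₀1 P Q
  exact (ho P).map φ.symm.trans

end Sylow

/-! ### Stability of the `p`-adic parameters -/

section Parameters

theorem emultiplicity_eq_of_dvd_sub {q x y : ℤ} {r : ℕ} (h : q ^ r ∣ y - x) (hx : ¬ q ^ r ∣ x) :
    emultiplicity q y = emultiplicity q x := by
  have hy : y = y - x + x := by ring
  rw [hy]
  exact emultiplicity_add_of_gt
    ((emultiplicity_lt_iff_not_dvd.2 hx).trans_le (le_emultiplicity_of_pow_dvd h))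

theorem emultiplicity_eq_or_le_of_dvd_sub {q x y : ℤ} {r : ℕ} (h : q ^ r ∣ y - x) :
    emultiplicity q y = emultiplicity q x ∨ (r ≤ emultiplicity q x ∧ r ≤ emultiplicity q y) := by
  by_cases hx : q ^ r ∣ x
  · exact Or.inr ⟨le_emultiplicity_of_pow_dvd hx,
      le_emultiplicity_of_pow_dvd ((dvd_sub_comm.1 h |> (dvd_sub_right hx).1))⟩
  · exact Or.inl (emultiplicity_eq_of_dvd_sub h hx)

variable {p : ℕ} [hp : Fact p.Prime]

theorem not_pow_valSubOne_succ_dvd {γ : ℤ} (hγ : γ ≠ 1) {r : ℕ} (hr : valSubOne p γ < r) :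
    ¬ (p : ℤ) ^ r ∣ γ - 1 := by
  rw [padicValInt_dvd_iff]
  rintro (h | h)
  · exact hγ (sub_eq_zero.1 h)
  · exact absurd h (not_le.2 hr)

theorem valSubOne_eq_of_dvd_sub {γ δ : ℤ} (hγ : γ ≠ 1) (hδ : δ ≠ 1) {r : ℕ}
    (h : (p : ℤ) ^ r ∣ δ - γ) (hr : valSubOne p γ < r) : valSubOne p δ = valSubOne p γ := by
  have hp1 : p ≠ 1 := hp.out.ne_one
  unfold valSubOne
  rw [padicValInt.of_ne_one_ne_zero hp1 (sub_ne_zero.2 hγ),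
    padicValInt.of_ne_one_ne_zero hp1 (sub_ne_zero.2 hδ)]
  refine multiplicity_eq_of_emultiplicity_eq
    (emultiplicity_eq_of_dvd_sub (r := r) ?_ (not_pow_valSubOne_succ_dvd hγ hr))
  rwa [sub_sub_sub_cancel_right]

theorem unitPart_sub_dvd {γ δ : ℤ} {r : ℕ} (h : (p : ℤ) ^ (valSubOne p γ + r) ∣ δ - γ)
    (hv : valSubOne p δ = valSubOne p γ) :
    (p : ℤ) ^ r ∣ unitPart p (δ - 1) - unitPart p (γ - 1) := by
  have h0 : (p : ℤ) ^ valSubOne p γ ≠ 0 := pow_ne_zero _ (by exact_mod_cast hp.out.ne_zero)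
  have e1 : unitPart p (δ - 1) = (δ - 1) / (p : ℤ) ^ valSubOne p γ := by rw [← hv]; rfl
  have e2 : unitPart p (γ - 1) = (γ - 1) / (p : ℤ) ^ valSubOne p γ := rfl
  obtain ⟨t, ht⟩ := h
  have e3 : δ - 1 = (γ - 1) + (p : ℤ) ^ valSubOne p γ * (p ^ r * t) := by
    rw [pow_add] at ht; linear_combination ht
  rw [e1, e2, e3, Int.add_mul_ediv_left _ _ h0, add_sub_cancel_left]
  exact dvd_mul_right _ _

end Parameters

/-! ### Transfer of the structure theorems -/

/-- Pairs of parameters that the structure theorems cannot tell apart. -/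
structure SameData (p : ℕ) (α β α₀ β₀ : ℤ) : Prop where
  m_eq : valSubOne p α₀ = valSubOne p α
  n_eq : valSubOne p β₀ = valSubOne p β
  l_eq : valDiff p α₀ β₀ = valDiff p α β
  mod_left : p = 3 → α₀ ≡ α [ZMOD 27]
  mod_right : p = 3 → β₀ ≡ β [ZMOD 27]
  s_odd : sOdd p α₀ β₀ = sOdd p α β ∨
    ((valSubOne p α + 1 : ℕ) ≤ sOdd p α β ∧ (valSubOne p α + 1 : ℕ) ≤ sOdd p α₀ β₀)
  s_two : p = 2 → sTwo α₀ β₀ = sTwo α β ∨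
    ((valSubOne p α + 1 : ℕ) ≤ sTwo α β ∧ (valSubOne p α + 1 : ℕ) ≤ sTwo α₀ β₀)

namespace SameData

variable {p : ℕ} {α β α₀ β₀ : ℤ}

theorem symm (h : SameData p α β α₀ β₀) : SameData p α₀ β₀ α β where
  m_eq := h.m_eq.symm
  n_eq := h.n_eq.symm
  l_eq := h.l_eq.symm
  mod_left hp := (h.mod_left hp).symm
  mod_right hp := (h.mod_right hp).symm
  s_odd := by rw [h.m_eq]; exact h.s_odd.imp Eq.symm And.symm
  s_two hp := by rw [h.m_eq]; exact (h.s_two hp).imp Eq.symm And.symm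

theorem not_two_mul_lt {x : ℕ∞} {m : ℕ} (h : (m + 1 : ℕ) ≤ x) : ¬ 2 * x < m := by
  intro h1
  have h2 : x ≠ ⊤ := by rintro rfl; simp at h1
  lift x to ℕ using h2
  norm_cast at h h1
  omega

theorem not_two_mul_add_lt {x : ℕ∞} {m : ℕ} (h : (m + 1 : ℕ) ≤ x) : ¬ 2 * x + 3 < m := fun h1 =>
  not_two_mul_lt h (lt_of_le_of_lt le_self_add h1)

theorem sameParameters (h : SameData p α β α₀ β₀) : SameParameters p α β α₀ β₀ where
  m_eq := h.m_eq
  n_eq := h.n_eq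
  l_eq := h.l_eq
  mod_left := h.mod_left
  mod_right := h.mod_right
  s_odd _ _ _ _ hs := h.s_odd.resolve_right fun h1 =>
    hs.elim (not_two_mul_lt h1.1) (not_two_mul_lt h1.2)
  s_two hp _ _ _ hs := (h.s_two hp).resolve_right fun h1 =>
    hs.elim (not_two_mul_add_lt h1.1) (not_two_mul_add_lt h1.2)

theorem modEq_nine (h : SameData p α β α₀ β₀) (hp : p = 3) (r : ℤ) :
    (α₀ ≡ r [ZMOD 9] ↔ α ≡ r [ZMOD 9]) ∧ (β₀ ≡ r [ZMOD 9] ↔ β ≡ r [ZMOD 9]) := by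
  have h1 : α₀ ≡ α [ZMOD 9] := (h.mod_left hp).of_dvd (by norm_num)
  have h2 : β₀ ≡ β [ZMOD 9] := (h.mod_right hp).of_dvd (by norm_num)
  exact ⟨⟨h1.symm.trans, h1.trans⟩, ⟨h2.symm.trans, h2.trans⟩⟩

theorem genericCase (h : SameData p α β α₀ β₀) (hg : GenericCase p α₀ β₀) :
    GenericCase p α β := by
  obtain ⟨h1, h2, h3⟩ := hg
  rw [h.m_eq] at h1
  rw [h.n_eq] at h2
  refine ⟨h1, h2, h3.imp_right fun ⟨hp, h4, h5⟩ => ⟨hp, ?_, ?_⟩⟩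
  · rwa [← (h.modEq_nine hp 7).1]
  · rwa [← (h.modEq_nine hp 7).2]

/-- The parameter `s` enters only through its vanishing, its value below or at a threshold, and
comparisons of `2 * s` or `2 * s + 3` with `m`. If both values are at least `m + 1`, they fall on
the same side everywhere. -/
theorem structureTheorem [Fact p.Prime] (h : SameData p α β α₀ β₀)
    (he : SylowEquivalent p α β α₀ β₀) (hα : α ≠ 1) (hβ : β ≠ 1) (hα₀ : α₀ ≠ 1) (hβ₀ : β₀ ≠ 1)
    {i : ℕ} (hi : StructureTheorem p α β i) : StructureTheorem p α₀ β₀ i := by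
  have O : ∀ {e oa ob oc : ℕ}, HasOrders p α β e oa ob oc → HasOrders p α₀ β₀ e oa ob oc :=
    fun ho => he.hasOrders hα hβ hα₀ hβ₀ ho
  have C : ∀ {f : ℕ}, HasClass p α β f → HasClass p α₀ β₀ f :=
    fun ho => he.hasClass hα hβ hα₀ hβ₀ ho
  have OC : ∀ {e oa ob oc f : ℕ}, HasOrders p α β e oa ob oc ∧ HasClass p α β f →
      HasOrders p α₀ β₀ e oa ob oc ∧ HasClass p α₀ β₀ f := fun h => ⟨O h.1, C h.2⟩
  have hg := h.genericCase
  have h9 := h.modEq_nine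
  unfold StructureTheorem at hi ⊢
  simp only [h.m_eq, h.n_eq, h.l_eq]
  split
  · exact fun a b c => OC (hi (hg a) b c)
  · exact fun a b c => OC (hi (hg a) b c)
  · exact fun a b d c1 c2 c3 c4 => OC (hi (hg a) b d c1 c2 c3 c4)
  · exact fun a b d c1 c2 c3 c4 => OC (hi (hg a) b d c1 c2 c3 c4)
  · intro a b c
    obtain ⟨i1, i2, i3, i4⟩ := hi (hg a) b c
    have hs := h.s_odd
    refine ⟨fun h0 => C (i1 ?_), fun h0 => C (i2 ?_), fun s h0 h1 => O (i3 s ?_ h1),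
      fun h0 => O (i4 ?_)⟩
    · rcases hs with hs | ⟨-, hs⟩
      · rw [← hs, h0]
      · rw [h0] at hs; norm_cast at hs
    · rcases hs with hs | ⟨hs, -⟩
      · rwa [← hs]
      · exact lt_of_lt_of_le (by norm_cast; omega) hs
    · rcases hs with hs | ⟨-, hs⟩
      · rw [← hs, h0]
      · rw [h0] at hs; norm_cast at hs; omega
    · rcases hs with hs | ⟨hs, -⟩
      · rwa [← hs]
      · exact not_lt.1 (not_two_mul_lt hs)
  · intro a b c d
    refine OC (hi a ((h9 a 7).1.1 b) ((h9 a 7).2.1 c) ?_)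
    exact (h.mod_left a).symm.trans (d.trans (h.mod_right a))
  · exact fun a b c d => OC (hi a ((h9 a 7).1.1 b) ((h9 a 7).2.1 c) d)
  · exact fun a b c => OC (hi a ((h9 a 7).1.1 b) ((h9 a 4).2.1 c))
  · exact fun a b c => OC (hi a ((h9 a 7).1.1 b) ((h9 a 1).2.1 c))
  · intro a b c
    obtain ⟨i1, i2, i3⟩ := hi a b c
    exact ⟨O i1, C i2, he.quaternion hα hβ hα₀ hβ₀ i3⟩
  · exact fun a b c => OC (hi a b c)
  · exact fun a b c => OC (hi a b c)
  · exact fun a b c d => OC (hi a b c d)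
  · exact fun a b c d => OC (hi a b c d)
  · exact fun a b c d => OC (hi a b c d)
  · exact fun a b c d => OC (hi a b c d)
  · intro a b c d
    obtain ⟨i1, i2, i3⟩ := hi a b c d
    have hs := h.s_two a
    refine ⟨C i1, fun s h0 h1 => ?_, fun h0 => O (i3 ?_)⟩
    · have h2 : sTwo α β = s := by
        rcases hs with hs | ⟨-, hs⟩
        · rw [← hs, h0]
        · rw [h0] at hs; norm_cast at hs; omega
      exact ⟨(i2 s h2 h1).1, O (i2 s h2 h1).2⟩
    · rcases hs with hs | ⟨hs, -⟩
      · rwa [← hs]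
      · exact not_lt.1 (not_two_mul_add_lt hs)
  · exact fun a b c d e1 e2 e3 => OC (hi a b c d e1 e2 e3)
  · exact fun a b c d e1 e2 e3 e4 e5 => OC (hi a b c d e1 e2 e3 e4 e5)
  · trivial

/-- Shifting both parameters by a multiple of a high power of `p` does not change the data. -/
theorem of_add [hp : Fact p.Prime] (hα : α ≠ 1) (hβ : β ≠ 1) {t : ℤ} {k : ℕ} (hk3 : 3 ≤ k)
    (hkα : 2 * valSubOne p α + 1 ≤ k) (hkβ : valSubOne p β < k) (hα₀ : α + p ^ k * t ≠ 1)
    (hβ₀ : β + p ^ k * t ≠ 1) : SameData p α β (α + p ^ k * t) (β + p ^ k * t) := by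
  have hdα : (p : ℤ) ^ k ∣ α + p ^ k * t - α := by rw [add_sub_cancel_left]; exact dvd_mul_right _ _
  have hdβ : (p : ℤ) ^ k ∣ β + p ^ k * t - β := by rw [add_sub_cancel_left]; exact dvd_mul_right _ _
  have hm : valSubOne p (α + p ^ k * t) = valSubOne p α :=
    valSubOne_eq_of_dvd_sub hα hα₀ hdα (by omega)
  have hsub : α + p ^ k * t - (β + p ^ k * t) = α - β := by ring
  have h27 : p = 3 → (27 : ℤ) ∣ p ^ k * t := by
    rintro rfl
    exact ((show (27 : ℤ) = 3 ^ 3 by norm_num) ▸ pow_dvd_pow 3 hk3).mul_right t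
  -- Dividing a shift by a multiple of `p ^ (2 * m + 1)` by `p ^ m` leaves `u` fixed modulo `p ^ (m
  -- + 1)`.
  have hu : (p : ℤ) ^ (valSubOne p α + 1) ∣
      unitPart p (α + p ^ k * t - 1) - unitPart p (α - 1) :=
    unitPart_sub_dvd ((pow_dvd_pow _ (by omega)).trans hdα) hm
  have hu3 : ∀ z : ℤ, (p : ℤ) ^ (valSubOne p α + 1) ∣
      (z - unitPart p (α + p ^ k * t - 1) ^ 3) - (z - unitPart p (α - 1) ^ 3) := by
    intro z
    rw [sub_sub_sub_cancel_left]
    exact (dvd_sub_comm.1 hu).trans (sub_dvd_pow_sub_pow _ _ 3)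
  exact {
    m_eq := hm
    n_eq := valSubOne_eq_of_dvd_sub hβ hβ₀ hdβ hkβ
    l_eq := by unfold valDiff; rw [hsub]
    mod_left := fun h => (Int.modEq_iff_dvd.2 (by simpa using h27 h)).symm
    mod_right := fun h => (Int.modEq_iff_dvd.2 (by simpa using h27 h)).symm
    s_odd := by
      unfold sOdd; rw [hsub]; exact emultiplicity_eq_or_le_of_dvd_sub (hu3 _)
    s_two := by
      rintro rfl
      unfold sTwo; rw [hsub]; exact emultiplicity_eq_or_le_of_dvd_sub (hu3 _) }

end SameData

theorem mainTheorem12 (α β : ℤ) (hα : α ≠ 1) (hβ : β ≠ 1) (p : ℕ) (hp : p.Prime) :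
    ∃ α₀ β₀ : ℤ, 1 < α₀ ∧ 1 < β₀ ∧
      (∀ (P : Sylow p (MacdonaldGroup α β)) (Q : Sylow p (MacdonaldGroup α₀ β₀)),
        ∃ (π : MacdonaldGroup α β →* P) (ρ : MacdonaldGroup α₀ β₀ →* Q) (φ : P ≃* Q),
          IsSylowProjection P π ∧ IsSylowProjection Q ρ ∧
          φ (π (genA α β)) = ρ (genA α₀ β₀) ∧ φ (π (genB α β)) = ρ (genB α₀ β₀)) ∧
      SameParameters p α β α₀ β₀ ∧
      ∀ i ∈ Finset.Icc 1 19, StructureTheorem p α₀ β₀ i ↔ StructureTheorem p α β i := by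
  have := Fact.mk hp
  -- This sum dominates all the bounds needed at once: the exponent of `P`, `2 * m + 1`, `n`, and
  -- `3` for the residues modulo 27. The choice of `t` makes both new parameters exceed `1`.
  set k := (Nat.card (MacdonaldGroup α β)).factorization p + 2 * valSubOne p α + valSubOne p β + 2
    with hk
  set t : ℤ := |α| + |β| + 2 with ht
  have hle : t ≤ p ^ (k + 1) * t := by
    have : (0 : ℤ) < p ^ (k + 1) := pow_pos (by exact_mod_cast hp.pos) _
    exact le_mul_of_one_le_left (by positivity) this
  have hα₀ : 1 < α + p ^ (k + 1) * t := by
    have := neg_abs_le α; have := abs_nonneg β; omega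
  have hβ₀ : 1 < β + p ^ (k + 1) * t := by
    have := neg_abs_le β; have := abs_nonneg α; omega
  have hdata : SameData p α β (α + p ^ (k + 1) * t) (β + p ^ (k + 1) * t) :=
    SameData.of_add hα hβ (by omega) (by omega) (by omega) hα₀.ne' hβ₀.ne'
  have he : SylowEquivalent p α β (α + p ^ (k + 1) * t) (β + p ^ (k + 1) * t) :=
    sylowEquivalent_of_dvd (k := k) hα hβ hα₀.ne' hβ₀.ne' (by omega) (by simp) (by simp)
  exact ⟨_, _, hα₀, hβ₀, he.exists_mulEquiv hα hβ hα₀.ne' hβ₀.ne', hdata.sameParameters,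
    fun i _ => ⟨hdata.symm.structureTheorem he.symm hα₀.ne' hβ₀.ne' hα hβ,
      hdata.structureTheorem he hα hβ hα₀.ne' hβ₀.ne'⟩⟩
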